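/- Let $n\ge 1$ and let $[n]=\mathrm{D}\sqcup\mathrm{U}$ be a partition with $1,n\in \mathrm{D}$ (the partition into down set and up set given by a Coxeter element $c$ of the symmetric group $\Sigma_n$); write $\mathrm{D}=\{d_1<\dots<d_\ell\}$, $\mathrm{U}=\{u_1<\dots<u_m\}$ and $\overline{\mathrm{D}}=\mathrm{D}\cup\{0,n+1\}$. Let $Q_c$ be a convex $(n+2)$-gon whose vertices are labelled, in counter-clockwise order, by $0,d_1,\dots,d_\ell,n+1,u_m,\dots,u_1$. For a proper diagonal $\delta=\{x,y\}$, $x<y$ (a pair of labels of non-adjacent vertices), let $R_\delta\subseteq[n]$ be the set of labels strictly to the right of $\delta$ oriented from $x$ to $y$, where $0$ is replaced by $x$ if $x\in\mathrm{U}$ and deleted otherwise, and $n+1$ is replaced by $y$ if $y\in\mathrm{U}$ and deleted otherwise. Let $$\mathrm{As}^c_{n-1}=\Bigl\{x\in\mathbb R^n:\ \sum_{i\in[n]}x_i=\tfrac{n(n+1)}2,\ \ \sum_{i\in R_\delta}x_i\ge\tfrac{|R_\delta|(|R_\delta|+1)}2\ \text{ for every proper diagonal }\delta\Bigr\}.$$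 For $\varnothing\ne I\subseteq[n]$ let $\Delta_I=\operatorname{conv}\{e_i: i\in I\}$. Real numbers $(y_I)_{\varnothing\neq I\subseteq[n]}$ are called Minkowski coefficients of $\mathrm{As}^c_{n-1}$ if $\mathrm{As}^c_{n-1}=\sum_I y_I\Delta_I$ as a Minkowski sum and difference, that is, $\mathrm{As}^c_{n-1}+\sum_{y_I<0}(-y_I)\Delta_I=\sum_{y_I>0}y_I\Delta_I$. For $a,b\in\overline{\mathrm{D}}$, $a<b$, let $(a,b)_{\mathrm D}=\{d\in \mathrm{D}:a<d<b\}$, and for $\alpha\le\beta$ in $\mathrm U$ let $[\alpha,\beta]_{\mathrm U}=\{u\in\mathrm U:\alpha\le u\le\beta\}$. Let $\varnothing\ne I\subseteq[n]$. Consider the non-empty inclusion-maximal down intervals $(a,b)_{\mathrm D}\subseteq I$, together with the empty down intervals $(d_r,d_{r+1})_{\mathrm D}$, $1\le r<\ell$, such that every one of these maximal down intervals $(a,b)_{\mathrm D}$ satisfies $b\le d_r$ or $d_{r+1}\le a$. The up intervals of the decomposition of $I$ are the sets $[\alpha,\beta]_{\mathrm U}\subseteq I$ that are contained in, and inclusion-maximal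 within, the open interval of integers $(a,b)$ for one of these (non-empty or empty) down intervals $(a,b)_{\mathrm D}$. The down intervals of the decomposition are the non-empty maximal ones and those empty ones $(a,b)_{\mathrm D}$ for which $(a,b)$ contains an up interval of the decomposition; empty down intervals with different end-points are distinguished. The decomposition of $I$ has type $(v,w)$ if it has $v$ down and $w$ up intervals, and $I$ is nested if $v=1$. If $I$ is nested with down interval $(a,b)_{\mathrm D}$, let $\gamma=\min I$ and $\Gamma=\max I$. Let $|K_\gamma|$ be the number of edges of the path in $\partial Q_c$ from $a$ to $\gamma$ that avoids $b$, and let $|K_\Gamma|$ be the number of edges of the path in $\partial Q_c$ from $b$ to $\Gamma$ that avoids $a$. The integer $K_\gamma$ (respectively $K_\Gamma$) is negative if and only if $\gamma\in\mathrm D$ (respectively $\Gamma\in\mathrm D$). Theorem. Minkowski coefficients $(y_I)$ of $\mathrm{As}^c_{n-1}$ exist, and they satisfy, for every non-empty $I\subseteq[n]$ of type $(v,w)$, $$y_I=\begin{cases}(-1)^{|I\setminus(a,b)_{\mathrm D}|}\,K_\gamma K_\Gamma & \text{if } v=1 \text{ and } I \text{ is not of the form } \{u_s\} \text{ with } u_s\in\mathrm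 U,\\ (-1)^{|I\setminus(a,b)_{\mathrm D}|}\,\bigl(K_\gamma K_\Gamma-(n+1)\bigr) & \text{if } I=\{u_s\} \text{ with } u_s\in\mathrm U,\\ 0 & \text{if } v\ge 2.\end{cases}$$ -/

import Mathlib

open scoped Pointwise

namespace CAssoc

/-! A Coxeter element of the symmetric group on `[n] = {1, …, n}` is encoded by its up set
`Up ⊆ {2, …, n - 1}`; the down set is the complement of `Up` in `[n]`. -/

/-- The down set. -/
def Do (n : ℕ) (Up : Finset ℕ) : Finset ℕ := Finset.Icc 1 n \ Up

/-- The extended down set `Do ∪ {0, n + 1}`. -/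
def DoBar (n : ℕ) (Up : Finset ℕ) : Finset ℕ := Do n Up ∪ {0, n + 1}

/-- The open down interval with end points `a`, `b`. -/
def downInt (n : ℕ) (Up : Finset ℕ) (a b : ℕ) : Finset ℕ :=
  (Do n Up).filter fun d => a < d ∧ d < b

/-- The closed up interval with end points `α`, `β`. -/
def upInt (Up : Finset ℕ) (α β : ℕ) : Finset ℕ :=
  Up.filter fun u => α ≤ u ∧ u ≤ β

/-! ### The up and down interval decomposition -/

/-- The non-empty inclusion-maximal down intervals of `I`, recorded by their end points. Such an
interval is maximal exactly when neither end point is an element of `I`. -/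
def maxDownIntervals (n : ℕ) (Up I : Finset ℕ) : Finset (ℕ × ℕ) :=
  (DoBar n Up ×ˢ DoBar n Up).filter fun p =>
    (downInt n Up p.1 p.2).Nonempty ∧ downInt n Up p.1 p.2 ⊆ I ∧ p.1 ∉ I ∧ p.2 ∉ I

/-- The empty down intervals with end points in `Do` that lie between (before, after) the
non-empty maximal down intervals of `I`, recorded by their end points. -/
def emptyDownIntervals (n : ℕ) (Up I : Finset ℕ) : Finset (ℕ × ℕ) :=
  (Do n Up ×ˢ Do n Up).filter fun p =>
    p.1 < p.2 ∧ downInt n Up p.1 p.2 = ∅ ∧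
      ∀ q ∈ maxDownIntervals n Up I, p.2 ≤ q.1 ∨ q.2 ≤ p.1

/-- `q = (α, β)` are the end points of an up interval of `I` which is contained in the open
interval of integers with end points `p`. -/
def IsUpIntervalIn (Up I : Finset ℕ) (p q : ℕ × ℕ) : Prop :=
  q.1 ≤ q.2 ∧ upInt Up q.1 q.2 ⊆ I ∧ p.1 < q.1 ∧ q.2 < p.2

instance (Up I : Finset ℕ) (p q : ℕ × ℕ) : Decidable (IsUpIntervalIn Up I p q) := by
  unfold IsUpIntervalIn; infer_instance

/-- The up intervals of the decomposition of `I`, recorded by their end points: those that are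
inclusion-maximal within one of the intervals of integers spanned by the down intervals above. -/
def upIntervals (n : ℕ) (Up I : Finset ℕ) : Finset (ℕ × ℕ) :=
  (Up ×ˢ Up).filter fun q =>
    ∃ p ∈ maxDownIntervals n Up I ∪ emptyDownIntervals n Up I,
      IsUpIntervalIn Up I p q ∧
        ∀ q' ∈ Up ×ˢ Up, IsUpIntervalIn Up I p q' → q'.1 ≤ q.1 → q.2 ≤ q'.2 → q' = q

/-- The down intervals of the decomposition of `I`, recorded by their end points: the non-empty
maximal ones, and the empty ones that span an up interval of the decomposition. -/
def downIntervals (n : ℕ) (Up I : Finset ℕ) : Finset (ℕ × ℕ) :=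
  maxDownIntervals n Up I ∪
    (emptyDownIntervals n Up I).filter fun p =>
      ∃ q ∈ upIntervals n Up I, p.1 < q.1 ∧ q.2 < p.2

/-- The type `(v, w)` of the up and down interval decomposition of `I`. -/
def decompType (n : ℕ) (Up I : Finset ℕ) : ℕ × ℕ :=
  ((downIntervals n Up I).card, (upIntervals n Up I).card)

/-! ### The labelled polygon -/

/-- The position of the label `x` among the vertices of the `(n + 2)`-gon, numbered
`0, …, n + 1` counter-clockwise: first `0`, the down elements increasingly and `n + 1`,
then the up elements decreasingly. -/
def pos (n : ℕ) (Up : Finset ℕ) (x : ℕ) : ℕ :=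
  if x ∈ Up then n + 2 - (Up.filter fun u => u ≤ x).card
  else ((DoBar n Up).filter fun d => d < x).card

/-- The number of boundary edges on the counter-clockwise boundary path from the vertex
labelled `x` to the vertex labelled `y`. -/
def ccw (n : ℕ) (Up : Finset ℕ) (x y : ℕ) : ℕ :=
  (pos n Up y + (n + 2) - pos n Up x) % (n + 2)

/-- The labels strictly between `x` and `y` on the counter-clockwise boundary path from `x` to
`y`, that is, the labels strictly on the right-hand side of the diagonal oriented from `x`
to `y`. -/
def arc (n : ℕ) (Up : Finset ℕ) (x y : ℕ) : Finset ℕ :=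
  (Finset.range (n + 2)).filter fun t => 0 < ccw n Up x t ∧ ccw n Up x t < ccw n Up x y

/-- `{x, y}` with `x < y` is a proper diagonal: its end points are not adjacent. -/
def IsProperDiagonal (n : ℕ) (Up : Finset ℕ) (x y : ℕ) : Prop :=
  x < y ∧ y ≤ n + 1 ∧ ccw n Up x y ≠ 1 ∧ ccw n Up y x ≠ 1

/-- The set `R_δ` of the diagonal `δ = {x, y}`, `x < y`: the labels strictly on the right-hand
side of `δ`, where `0` is replaced by the smaller end point `x` if `x ∈ Up` and `n + 1` is
replaced by the larger end point `y` if `y ∈ Up` (and they are dropped otherwise). -/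
def R (n : ℕ) (Up : Finset ℕ) (x y : ℕ) : Finset ℕ :=
  (arc n Up x y \ {0, n + 1})
    ∪ (if 0 ∈ arc n Up x y ∧ x ∈ Up then {x} else ∅)
    ∪ (if n + 1 ∈ arc n Up x y ∧ y ∈ Up then {y} else ∅)

/-- The number of edges of the boundary path that connects `x` and `y` and avoids `z`. -/
def pathLength (n : ℕ) (Up : Finset ℕ) (x y z : ℕ) : ℕ :=
  if z ∈ arc n Up x y then ccw n Up y x else ccw n Up x y

/-- The signed length of the boundary path that connects `x` and `y` and avoids `z`; the sign is
negative exactly when `y` is a down element. -/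
def signedLength (n : ℕ) (Up : Finset ℕ) (x y z : ℕ) : ℤ :=
  if y ∈ Do n Up then -(pathLength n Up x y z : ℤ) else (pathLength n Up x y z : ℤ)

/-! ### The associahedron and Minkowski decompositions -/

/-- The sum of the coordinates of `x ∈ ℝ^[n]` with index in `I`. -/
def coordSum (n : ℕ) (x : Finset.Icc 1 n → ℝ) (I : Finset ℕ) : ℝ :=
  ∑ i : Finset.Icc 1 n, if (i : ℕ) ∈ I then x i else 0

/-- The associahedron: the polytope in `ℝ^[n]` given by the equation `∑ x_i = n (n + 1) / 2` and
one inequality `∑_{i ∈ R_δ} x_i ≥ |R_δ| (|R_δ| + 1) / 2` for each proper diagonal `δ`. -/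
def associahedron (n : ℕ) (Up : Finset ℕ) : Set (Finset.Icc 1 n → ℝ) :=
  {x | coordSum n x (Finset.Icc 1 n) = (n : ℝ) * (n + 1) / 2 ∧
    ∀ d e : ℕ, IsProperDiagonal n Up d e →
      ((R n Up d e).card : ℝ) * ((R n Up d e).card + 1) / 2 ≤ coordSum n x (R n Up d e)}

/-- The face of the standard simplex spanned by the standard basis vectors `e_i`, `i ∈ I`. -/
noncomputable def simplexFace (n : ℕ) (I : Finset ℕ) : Set (Finset.Icc 1 n → ℝ) :=
  convexHull ℝ {v | ∃ i : Finset.Icc 1 n, (i : ℕ) ∈ I ∧ v = Pi.single i 1}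

/-- `P = ∑ y_I Δ_I`, as a Minkowski sum and difference over the non-empty subsets `I` of `[n]`:
adding to `P` the dilated faces with negative coefficient (scaled by `-y_I`) gives the Minkowski
sum of the dilated faces with positive coefficient. -/
def IsMinkowskiDecomposition (n : ℕ) (P : Set (Finset.Icc 1 n → ℝ)) (y : Finset ℕ → ℝ) : Prop :=
  P + ∑ I ∈ (Finset.Icc 1 n).powerset with I.Nonempty, max (-y I) 0 • simplexFace n I
    = ∑ I ∈ (Finset.Icc 1 n).powerset with I.Nonempty, max (y I) 0 • simplexFace n I

end CAssoc

namespace CAssoc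

/-! A closed convex set with a support function `Z` in the sense of `HasSupport` is determined by
the numbers `Z J`: a linear functional orders the coordinates, and summation by parts shows that the
common tight point of that order minimises it (`HasSupport.mem_of_le`). Support functions add under
Minkowski sums, and that of a simplex face is the indicator of `I ⊆ J`. Hence `y` is a Minkowski
decomposition exactly when the sums of `y I` over non-empty `I ⊆ J` equal `Z J`
(`isMinkowskiDecomposition_iff`). This triangular system has one solution on the non-empty subsets
of `[n]`, which gives existence and leaves a Möbius inversion.

The support function of the associahedron is read off from a path. For `J ⊆ [n]`, go from `0` to `n
+ 1` through the down labels outside `J` and the up labels inside `J`, in increasing order. The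
complements of the sets `R` of its edges cover `[n]` so evenly that their coordinate sums add up to
a multiple of the total minus the sum over `J` (`sum_coordSum_compl`). Adding the facet inequalities
along the path bounds the sum over `J` below by `suppFun`. The bound is attained because `suppFun`
is supermodular and agrees with the prescribed right-hand sides on each `R`: greedy points satisfy
all the inequalities.

Since `|R|` is `endPos y - startPos x - 1`, an edge contributes a quadratic polynomial in a
difference of positions, whose mixed second difference factors (`edgeDefect_second_difference`).
This factorisation gives both supermodularity and the product formula. An edge lies on the path of
`J` exactly when `J ∩ [x, y]` is a fixed set, `edgeCore`, so Möbius inversion works edge by edge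
(`sum_coreSum`). For nested `I` with down interval `(a, b)`, minimum `g` and maximum `G`, the
surviving edges join `a` or `g` to `b` or `G` with alternating signs, and the factors of their
second difference are the two signed path lengths. If `I` is a singleton the edge from `g` to itself
is missing; this is the source of the correction `n + 1`. With two or more down intervals no edge
survives. -/

/-! ### Coordinate sums and support functions under Minkowski operations. -/

/-- The coordinate of `x` with index `i`, and zero if there is none. -/
noncomputable def coord (n : ℕ) (x : Finset.Icc 1 n → ℝ) (i : ℕ) : ℝ :=
  if h : i ∈ Finset.Icc 1 n then x ⟨i, h⟩ else 0

theorem coordSum_eq_sum_Icc (n : ℕ) (x : Finset.Icc 1 n → ℝ) (J : Finset ℕ) :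
    coordSum n x J = ∑ i ∈ Finset.Icc 1 n, if i ∈ J then coord n x i else 0 := by
  rw [coordSum, ← Finset.sum_coe_sort (Finset.Icc 1 n)]
  refine Finset.sum_congr rfl fun i _ => ?_
  rw [coord, dif_pos i.2]

theorem coordSum_eq_sum {n : ℕ} (x : Finset.Icc 1 n → ℝ) {J : Finset ℕ}
    (hJ : J ⊆ Finset.Icc 1 n) : coordSum n x J = ∑ i ∈ J, coord n x i := by
  rw [coordSum_eq_sum_Icc, Finset.sum_ite_mem, Finset.inter_eq_right.2 hJ]

theorem coordSum_add (n : ℕ) (x y : Finset.Icc 1 n → ℝ) (J : Finset ℕ) :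
    coordSum n (x + y) J = coordSum n x J + coordSum n y J := by
  simp only [coordSum, ← Finset.sum_add_distrib]
  refine Finset.sum_congr rfl fun i _ => ?_
  split_ifs <;> simp

theorem coordSum_smul (n : ℕ) (c : ℝ) (x : Finset.Icc 1 n → ℝ) (J : Finset ℕ) :
    coordSum n (c • x) J = c * coordSum n x J := by
  simp only [coordSum, Finset.mul_sum]
  refine Finset.sum_congr rfl fun i _ => ?_
  split_ifs <;> simp

theorem continuous_coordSum (n : ℕ) (J : Finset ℕ) : Continuous fun x => coordSum n x J := by
  unfold coordSum
  refine continuous_finsetSum _ fun i _ => ?_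
  split_ifs <;> fun_prop

/-- The elements of `[n]` on which `ρ` is at least `t`. -/
def superlevel (n : ℕ) (ρ : ℕ → ℕ) (t : ℕ) : Finset ℕ :=
  (Finset.Icc 1 n).filter fun i => t ≤ ρ i

theorem superlevel_subset (n : ℕ) (ρ : ℕ → ℕ) (t : ℕ) : superlevel n ρ t ⊆ Finset.Icc 1 n :=
  Finset.filter_subset _ _

/-- `Z` bounds the coordinate sums on `X` from below, and for each total order of `[n]` the bounds
of all upper sets of the order are attained at one common point. -/
structure HasSupport (n : ℕ) (X : Set (Finset.Icc 1 n → ℝ)) (Z : Finset ℕ → ℝ) : Prop where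
  total : ∀ x ∈ X, coordSum n x (Finset.Icc 1 n) = Z (Finset.Icc 1 n)
  le : ∀ x ∈ X, ∀ J ⊆ Finset.Icc 1 n, Z J ≤ coordSum n x J
  tight : ∀ ρ : ℕ → ℕ, Set.InjOn ρ (Finset.Icc 1 n) → ∃ p ∈ X, ∀ t,
    coordSum n p (superlevel n ρ t) = Z (superlevel n ρ t)

/-- Tight points of the two summands for the same order add up to a tight point of the sum. -/
theorem HasSupport.add {n : ℕ} {X Y : Set (Finset.Icc 1 n → ℝ)} {Z W : Finset ℕ → ℝ}
    (hX : HasSupport n X Z) (hY : HasSupport n Y W) : HasSupport n (X + Y) (Z + W) where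
  total := by
    rintro _ ⟨x, hx, y, hy, rfl⟩
    simp only [coordSum_add, Pi.add_apply, hX.total x hx, hY.total y hy]
  le := by
    rintro _ ⟨x, hx, y, hy, rfl⟩ J hJ
    simp only [coordSum_add, Pi.add_apply]
    exact add_le_add (hX.le x hx J hJ) (hY.le y hy J hJ)
  tight ρ hρ := by
    obtain ⟨p, hp, h⟩ := hX.tight ρ hρ
    obtain ⟨r, hr, h'⟩ := hY.tight ρ hρ
    exact ⟨p + r, Set.add_mem_add hp hr, fun t => by
      rw [coordSum_add, h, h', Pi.add_apply]⟩

theorem HasSupport.smul {n : ℕ} {X : Set (Finset.Icc 1 n → ℝ)} {Z : Finset ℕ → ℝ} {c : ℝ}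
    (hc : 0 ≤ c) (hX : HasSupport n X Z) : HasSupport n (c • X) (c • Z) where
  total := by
    rintro _ ⟨x, hx, rfl⟩
    simp only [coordSum_smul, Pi.smul_apply, hX.total x hx, smul_eq_mul]
  le := by
    rintro _ ⟨x, hx, rfl⟩ J hJ
    simp only [coordSum_smul, Pi.smul_apply, smul_eq_mul]
    exact mul_le_mul_of_nonneg_left (hX.le x hx J hJ) hc
  tight ρ hρ := by
    obtain ⟨p, hp, h⟩ := hX.tight ρ hρ
    exact ⟨c • p, Set.smul_mem_smul_set hp, fun t => by
      rw [coordSum_smul, h, Pi.smul_apply, smul_eq_mul]⟩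

theorem HasSupport.sum {n : ℕ} {ι : Type*} (s : Finset ι) {X : ι → Set (Finset.Icc 1 n → ℝ)}
    {Z : ι → Finset ℕ → ℝ} (h : ∀ i ∈ s, HasSupport n (X i) (Z i)) :
    HasSupport n (∑ i ∈ s, X i) (∑ i ∈ s, Z i) := by
  classical
  induction s using Finset.induction_on with
  | empty =>
    have h0 : ∀ J, coordSum n 0 J = 0 := fun J => by simp [coordSum]
    refine ⟨?_, ?_, fun ρ _ => ⟨0, by simp, fun t => by simp [h0]⟩⟩ <;> simp [h0]
  | insert a s ha ih =>
    rw [Finset.sum_insert ha, Finset.sum_insert ha]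
    exact (h a (Finset.mem_insert_self a s)).add
      (ih fun i hi => h i (Finset.mem_insert_of_mem hi))

theorem coordSum_single (n : ℕ) (i : Finset.Icc 1 n) (J : Finset ℕ) :
    coordSum n (Pi.single i 1) J = if (i : ℕ) ∈ J then 1 else 0 := by
  rw [coordSum, Finset.sum_eq_single i]
  · simp
  · intro j _ hj
    simp [hj]
  · simp

/-- The tight point is the vertex at the lowest element of `I`: an upper set contains that element
exactly when it contains all of `I`. -/
theorem hasSupport_simplexFace {n : ℕ} {I : Finset ℕ} (hI : I ⊆ Finset.Icc 1 n)
    (hne : I.Nonempty) :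
    HasSupport n (simplexFace n I) fun J => if I ⊆ J then 1 else 0 where
  total := by
    intro x hx
    have hsub : simplexFace n I ⊆ {x | coordSum n x (Finset.Icc 1 n) = 1} := by
      refine convexHull_min ?_ ?_
      · rintro _ ⟨i, hi, rfl⟩
        rw [Set.mem_ofPred_eq, coordSum_single, if_pos i.2]
      · intro x hx y hy a b _ _ hab
        simp only [Set.mem_ofPred_eq] at hx hy ⊢
        rw [coordSum_add, coordSum_smul, coordSum_smul, hx, hy]
        linarith
    rw [if_pos hI]
    exact hsub hx
  le := by
    intro x hx J _
    have hsub : simplexFace n I ⊆ {x | (if I ⊆ J then 1 else 0) ≤ coordSum n x J} := by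
      refine convexHull_min ?_ ?_
      · rintro _ ⟨i, hi, rfl⟩
        rw [Set.mem_ofPred_eq, coordSum_single]
        split_ifs with h1 h2 h2
        · exact le_rfl
        · exact absurd (h1 hi) h2
        · exact zero_le_one
        · exact le_rfl
      · intro x hx y hy a b ha hb hab
        simp only [Set.mem_ofPred_eq] at hx hy ⊢
        rw [coordSum_add, coordSum_smul, coordSum_smul]
        calc _ = a * (if I ⊆ J then 1 else 0) + b * (if I ⊆ J then 1 else 0) := by
              rw [← add_mul, hab, one_mul]
          _ ≤ _ := add_le_add (mul_le_mul_of_nonneg_left hx ha) (mul_le_mul_of_nonneg_left hy hb)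
    exact hsub hx
  tight ρ _ := by
    obtain ⟨i, hi, hmin⟩ := Finset.exists_min_image I ρ hne
    refine ⟨Pi.single ⟨i, hI hi⟩ 1, subset_convexHull ℝ _ ⟨_, hi, rfl⟩, fun t => ?_⟩
    rw [coordSum_single]
    refine if_congr ?_ rfl rfl
    simp only [superlevel, Finset.mem_filter]
    refine ⟨fun h j hj => Finset.mem_filter.2 ⟨hI hj, h.2.trans (hmin j hj)⟩, fun h => ?_⟩
    exact Finset.mem_filter.1 (h hi)

/-! ### Recovering a closed convex set from its support function. -/

/-- Summation by parts. -/
theorem sum_mul_nonneg_of_superlevel (s : Finset ℕ) (ρ : ℕ → ℕ) (c w : ℕ → ℝ)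
    (hρ : Set.InjOn ρ s) (hc : ∀ i ∈ s, ∀ j ∈ s, ρ i < ρ j → c i ≤ c j)
    (hw : ∀ t, 0 ≤ ∑ i ∈ s with t ≤ ρ i, w i) (m : ℝ) (hm : ∀ i ∈ s, m ≤ c i) :
    0 ≤ ∑ i ∈ s, (c i - m) * w i := by
  induction s using Finset.strongInduction generalizing m with
  | H s ih =>
    rcases s.eq_empty_or_nonempty with rfl | hne
    · simp
    obtain ⟨k, hk, hmin⟩ := Finset.exists_min_image s ρ hne
    have hlt : ∀ i ∈ s.erase k, ρ k < ρ i := fun i hi => by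
      have hi' := Finset.mem_erase.1 hi
      exact lt_of_le_of_ne (hmin i hi'.2) fun h => hi'.1 (hρ hi'.2 hk h.symm)
    have h1 := ih (s.erase k) (Finset.erase_ssubset hk)
      (hρ.mono (Finset.coe_subset.2 (Finset.erase_subset k s)))
      (fun i hi j hj => hc i (Finset.mem_of_mem_erase hi) j (Finset.mem_of_mem_erase hj))
      (fun t => by
        -- Removing the lowest element `k` amounts to raising the threshold above `ρ k`.
        convert hw (max t (ρ k + 1)) using 2
        ext i
        simp only [Finset.mem_filter, Finset.mem_erase]
        constructor
        · rintro ⟨h, h'⟩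
          have := hlt i (Finset.mem_erase.2 h)
          exact ⟨h.2, max_le h' this⟩
        · rintro ⟨h, h'⟩
          rw [max_le_iff] at h'
          refine ⟨⟨?_, h⟩, h'.1⟩
          rintro rfl
          omega)
      (c k) (fun i hi => hc k hk i (Finset.mem_of_mem_erase hi) (hlt i hi))
    have h2 : 0 ≤ ∑ i ∈ s, w i := by simpa using hw 0
    have h3 : ∑ i ∈ s, (c i - m) * w i
        = ∑ i ∈ s.erase k, (c i - c k) * w i + (c k - m) * ∑ i ∈ s, w i := by
      have h4 : ∑ i ∈ s.erase k, (c i - c k) * w i = ∑ i ∈ s, (c i - c k) * w i := by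
        rw [← Finset.sum_erase_add s _ hk]
        simp
      rw [h4, Finset.mul_sum, ← Finset.sum_add_distrib]
      exact Finset.sum_congr rfl fun i _ => by ring
    rw [h3]
    exact add_nonneg h1 (mul_nonneg (sub_nonneg.2 (hm k hk)) h2)

/-- Every real-valued function on a finite set is monotone for some total order. -/
theorem exists_injOn_rank (s : Finset ℕ) (c : ℕ → ℝ) :
    ∃ ρ : ℕ → ℕ, Set.InjOn ρ s ∧ ∀ i ∈ s, ∀ j ∈ s, ρ i < ρ j → c i ≤ c j := by
  classical
  -- Ties of `c` are broken by the index itself; the rank counts the elements with smaller key.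
  let key : ℕ → ℝ ×ₗ ℕ := fun i => toLex (c i, i)
  let ρ : ℕ → ℕ := fun i => (s.filter fun j => key j < key i).card
  have hmono : ∀ i ∈ s, ∀ j, key i < key j → ρ i < ρ j := by
    intro i hi j h
    refine Finset.card_lt_card ?_
    rw [Finset.ssubset_iff_of_subset]
    · exact ⟨i, by simp [hi, h], by simp⟩
    · intro k hk
      rw [Finset.mem_filter] at hk ⊢
      exact ⟨hk.1, hk.2.trans h⟩
  have hkey : ∀ i j, key i = key j → i = j := fun i j h => by
    have := congrArg (fun x => (ofLex x).2) h
    simpa [key] using this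
  refine ⟨ρ, ?_, ?_⟩
  · intro i hi j hj h
    rcases lt_trichotomy (key i) (key j) with h' | h' | h'
    · exact absurd h (hmono i hi j h').ne
    · exact hkey i j h'
    · exact absurd h (hmono j hj i h').ne'
  · intro i hi j hj h
    by_contra hlt
    rw [not_le] at hlt
    have : key j < key i := by
      rw [Prod.Lex.toLex_lt_toLex]
      exact Or.inl hlt
    exact absurd (hmono j hj i this) (not_lt.2 h.le)

/-- A point outside `X` would be strictly separated from it by a functional `f`. Order the
coordinates by the coefficients of `f` and take the tight point `p` of that order. The sums of `x`
over upper sets dominate those of `p` and the totals agree, so `f p ≤ f x`, against the separation.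
-/
theorem HasSupport.mem_of_le {n : ℕ} {X : Set (Finset.Icc 1 n → ℝ)} {Z : Finset ℕ → ℝ}
    (hX : HasSupport n X Z) (hconv : Convex ℝ X) (hclosed : IsClosed X)
    {x : Finset.Icc 1 n → ℝ} (hx : coordSum n x (Finset.Icc 1 n) = Z (Finset.Icc 1 n))
    (hle : ∀ J ⊆ Finset.Icc 1 n, Z J ≤ coordSum n x J) : x ∈ X := by
  by_contra hmem
  obtain ⟨f, u, hfx, hfX⟩ := geometric_hahn_banach_point_closed hconv hclosed hmem
  set c : ℕ → ℝ := fun i => if h : i ∈ Finset.Icc 1 n then f (Pi.single ⟨i, h⟩ 1) else 0 with hcdef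
  obtain ⟨ρ, hρ, hmono⟩ := exists_injOn_rank (Finset.Icc 1 n) c
  obtain ⟨p, hp, htight⟩ := hX.tight ρ hρ
  have hf : ∀ y : Finset.Icc 1 n → ℝ, f y = ∑ i ∈ Finset.Icc 1 n, c i * coord n y i := by
    intro y
    rw [← Finset.sum_coe_sort]
    conv_lhs => rw [pi_eq_sum_univ' y]
    rw [map_sum]
    refine Finset.sum_congr rfl fun i _ => ?_
    rw [map_smul, smul_eq_mul, coord, dif_pos i.2, hcdef]
    simp only [i.2, dif_pos]
    rw [mul_comm]
  obtain ⟨m, hm⟩ : ∃ m : ℝ, ∀ i ∈ Finset.Icc 1 n, m ≤ c i := by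
    obtain ⟨m, hm⟩ := ((Finset.Icc 1 n).image c).bddBelow
    exact ⟨m, fun i hi => hm (Finset.mem_coe.2 (Finset.mem_image_of_mem c hi))⟩
  have key := sum_mul_nonneg_of_superlevel (Finset.Icc 1 n) ρ c
    (fun i => coord n x i - coord n p i) hρ hmono (fun t => by
      rw [Finset.sum_sub_distrib]
      have h1 := hle _ (superlevel_subset n ρ t)
      rw [← htight t, coordSum_eq_sum _ (superlevel_subset n ρ t),
        coordSum_eq_sum _ (superlevel_subset n ρ t)] at h1
      exact sub_nonneg.2 h1) m hm
  have htot : ∑ i ∈ Finset.Icc 1 n, coord n x i = ∑ i ∈ Finset.Icc 1 n, coord n p i := by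
    rw [← coordSum_eq_sum x subset_rfl, ← coordSum_eq_sum p subset_rfl, hx, hX.total p hp]
  have h2 : ∑ i ∈ Finset.Icc 1 n, (c i - m) * (coord n x i - coord n p i) = f x - f p := by
    rw [hf x, hf p]
    have : ∀ i, (c i - m) * (coord n x i - coord n p i)
      = (c i * coord n x i - c i * coord n p i) - m * (coord n x i - coord n p i) :=
      fun i => by ring
    simp only [this, Finset.sum_sub_distrib, ← Finset.mul_sum, htot]
    ring
  rw [h2] at key
  linarith [hfX p hp]

theorem HasSupport.set_eq {n : ℕ} {X Y : Set (Finset.Icc 1 n → ℝ)} {Z : Finset ℕ → ℝ}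
    {W : Finset ℕ → ℝ}
    (hX : HasSupport n X Z) (hXconv : Convex ℝ X) (hXclosed : IsClosed X)
    (hY : HasSupport n Y W) (hYconv : Convex ℝ Y) (hYclosed : IsClosed Y)
    (h : ∀ J ⊆ Finset.Icc 1 n, Z J = W J) : X = Y := by
  ext x
  constructor
  · intro hx
    exact hY.mem_of_le hYconv hYclosed ((hX.total x hx).trans (h _ subset_rfl))
      fun J hJ => (h J hJ).symm.trans_le (hX.le x hx J hJ)
  · intro hx
    exact hX.mem_of_le hXconv hXclosed ((hY.total x hx).trans (h _ subset_rfl).symm)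
      fun J hJ => (h J hJ).trans_le (hY.le x hx J hJ)

theorem HasSupport.exists_eq {n : ℕ} {X : Set (Finset.Icc 1 n → ℝ)} {Z : Finset ℕ → ℝ}
    (hX : HasSupport n X Z) {J : Finset ℕ} (hJ : J ⊆ Finset.Icc 1 n) :
    ∃ p ∈ X, coordSum n p J = Z J := by
  -- This order places `J` above the rest of `[n]`, so threshold `n + 1` cuts out exactly `J`.
  obtain ⟨p, hp, h⟩ := hX.tight (fun i => if i ∈ J then n + 1 + i else i) (by
    intro i hi j hj hij
    have h1 := Finset.mem_Icc.1 (Finset.mem_coe.1 hi)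
    have h2 := Finset.mem_Icc.1 (Finset.mem_coe.1 hj)
    simp only at hij
    split_ifs at hij <;> omega)
  have hlev : superlevel n (fun i => if i ∈ J then n + 1 + i else i) (n + 1) = J := by
    ext i
    simp only [superlevel, Finset.mem_filter]
    constructor
    · rintro ⟨h1, h2⟩
      by_contra h3
      rw [if_neg h3] at h2
      have := Finset.mem_Icc.1 h1
      omega
    · intro h
      refine ⟨hJ h, ?_⟩
      rw [if_pos h]
      omega
  exact ⟨p, hp, by simpa [hlev] using h (n + 1)⟩

theorem HasSupport.unique {n : ℕ} {X : Set (Finset.Icc 1 n → ℝ)} {Z W : Finset ℕ → ℝ}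
    (hX : HasSupport n X Z) (hY : HasSupport n X W) {J : Finset ℕ} (hJ : J ⊆ Finset.Icc 1 n) :
    Z J = W J := by
  obtain ⟨p, hp, h⟩ := hX.exists_eq hJ
  obtain ⟨r, hr, h'⟩ := hY.exists_eq hJ
  exact le_antisymm ((hX.le r hr J hJ).trans_eq h') ((hY.le p hp J hJ).trans_eq h)

/-! ### Greedy points. -/

/-- Greedy algorithm for a function with increasing marginals. -/
theorem exists_greedy {n : ℕ} {Z : Finset ℕ → ℝ} (h0 : Z ∅ = 0)
    (hZ : ∀ A B : Finset ℕ, A ⊆ B → B ⊆ Finset.Icc 1 n → ∀ i ∈ Finset.Icc 1 n, i ∉ B →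
      Z (insert i A) - Z A ≤ Z (insert i B) - Z B)
    (ρ : ℕ → ℕ) (hρ : Set.InjOn ρ (Finset.Icc 1 n)) :
    ∃ p : Finset.Icc 1 n → ℝ,
      (∀ t, coordSum n p (superlevel n ρ t) = Z (superlevel n ρ t)) ∧
      ∀ J ⊆ Finset.Icc 1 n, Z J ≤ coordSum n p J := by
  -- The coordinate at `i` is the gain of `Z` when `i` joins the elements above it.
  let p : Finset.Icc 1 n → ℝ := fun i =>
    Z (superlevel n ρ (ρ i)) - Z (superlevel n ρ (ρ i + 1))
  have hins : ∀ i ∈ Finset.Icc 1 n,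
      insert i (superlevel n ρ (ρ i + 1)) = superlevel n ρ (ρ i) := by
    intro i hi
    ext j
    simp only [superlevel, Finset.mem_insert, Finset.mem_filter]
    constructor
    · rintro (rfl | h)
      · exact ⟨hi, le_rfl⟩
      · exact ⟨h.1, by omega⟩
    · rintro ⟨h1, h2⟩
      by_cases h : ρ j = ρ i
      · exact Or.inl (hρ h1 hi h)
      · exact Or.inr ⟨h1, by omega⟩
  have hcoord : ∀ i ∈ Finset.Icc 1 n, coord n p i =
      Z (superlevel n ρ (ρ i)) - Z (superlevel n ρ (ρ i + 1)) := by
    intro i hi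
    rw [coord, dif_pos hi]
  refine ⟨p, fun t => ?_, fun J hJ => ?_⟩
  · induction hk : (superlevel n ρ t).card using Nat.strong_induction_on generalizing t with
    | h k ih =>
      rcases (superlevel n ρ t).eq_empty_or_nonempty with he | hne
      · rw [he, h0, coordSum_eq_sum p (Finset.empty_subset _), Finset.sum_empty]
      obtain ⟨i, hi, hmin⟩ := Finset.exists_min_image _ ρ hne
      have hi' := Finset.mem_filter.1 hi
      have heq : superlevel n ρ t = superlevel n ρ (ρ i) := by
        ext j
        simp only [superlevel, Finset.mem_filter]
        refine and_congr_right fun hj => ⟨fun h => ?_, fun h => hi'.2.trans h⟩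
        exact hmin j (Finset.mem_filter.2 ⟨hj, h⟩)
      have hnot : i ∉ superlevel n ρ (ρ i + 1) := by simp [superlevel]
      have hcard : (superlevel n ρ (ρ i + 1)).card < k := by
        rw [← hk, heq, ← hins i hi'.1, Finset.card_insert_of_notMem hnot]
        omega
      have := ih _ hcard (ρ i + 1) rfl
      rw [heq, coordSum_eq_sum p (superlevel_subset n ρ _), ← hins i hi'.1,
        Finset.sum_insert hnot, ← coordSum_eq_sum p (superlevel_subset n ρ _), this,
        hcoord i hi'.1, hins i hi'.1]
      ring
  · induction J using Finset.strongInduction with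
    | H J ih =>
      rcases J.eq_empty_or_nonempty with rfl | hne
      · rw [h0, coordSum_eq_sum p (Finset.empty_subset _), Finset.sum_empty]
      obtain ⟨i, hi, hmin⟩ := Finset.exists_min_image _ ρ hne
      have h1 := ih (J.erase i) (Finset.erase_ssubset hi) ((Finset.erase_subset i J).trans hJ)
      -- With `i` lowest in `J`, the rest of `J` lies in the strict upper set of `i`, so adding `i`
      -- to that rest gains at most the greedy coordinate.
      have h2 := hZ (J.erase i) (superlevel n ρ (ρ i + 1)) (by
        intro j hj
        have hj' := Finset.mem_erase.1 hj
        refine Finset.mem_filter.2 ⟨hJ hj'.2, ?_⟩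
        exact Nat.lt_of_le_of_ne (hmin j hj'.2) fun h => hj'.1 (hρ (hJ hj'.2) (hJ hi) h.symm))
        (superlevel_subset n ρ _) i (hJ hi) (by simp [superlevel])
      rw [Finset.insert_erase hi, hins i (hJ hi), ← hcoord i (hJ hi)] at h2
      rw [coordSum_eq_sum p ((Finset.erase_subset i J).trans hJ)] at h1
      rw [coordSum_eq_sum p hJ, ← Finset.sum_erase_add J _ hi]
      linarith

/-! ### Minkowski decompositions as a linear system. -/

theorem convex_simplexFace (n : ℕ) (I : Finset ℕ) : Convex ℝ (simplexFace n I) :=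
  convex_convexHull ℝ _

theorem isCompact_simplexFace (n : ℕ) (I : Finset ℕ) : IsCompact (simplexFace n I) := by
  refine Set.Finite.isCompact_convexHull (𝕜 := ℝ) ?_
  refine (Set.finite_range fun i : Finset.Icc 1 n => (Pi.single i 1 : Finset.Icc 1 n → ℝ)).subset ?_
  rintro _ ⟨i, _, rfl⟩
  exact ⟨i, rfl⟩

theorem convex_isCompact_sum {E ι : Type*} [AddCommGroup E] [Module ℝ E] [TopologicalSpace E]
    [ContinuousAdd E] (s : Finset ι) {X : ι → Set E}
    (h : ∀ i ∈ s, Convex ℝ (X i) ∧ IsCompact (X i)) :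
    Convex ℝ (∑ i ∈ s, X i) ∧ IsCompact (∑ i ∈ s, X i) := by
  classical
  induction s using Finset.induction_on with
  | empty => exact ⟨convex_singleton 0, isCompact_singleton⟩
  | insert a s ha ih =>
    rw [Finset.sum_insert ha]
    have h1 := h a (Finset.mem_insert_self a s)
    have h2 := ih fun i hi => h i (Finset.mem_insert_of_mem hi)
    exact ⟨h1.1.add h2.1, h1.2.add h2.2⟩

/-- Minkowski decompositions of a polytope with given support function. -/
theorem isMinkowskiDecomposition_iff {n : ℕ} {P : Set (Finset.Icc 1 n → ℝ)} {Z : Finset ℕ → ℝ}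
    (hP : HasSupport n P Z) (hconv : Convex ℝ P) (hclosed : IsClosed P) (y : Finset ℕ → ℝ) :
    IsMinkowskiDecomposition n P y ↔
      ∀ J ⊆ Finset.Icc 1 n, ∑ I ∈ J.powerset with I.Nonempty, y I = Z J := by
  let S := (Finset.Icc 1 n).powerset.filter fun I => I.Nonempty
  have hsup : ∀ c : Finset ℕ → ℝ, (∀ I, 0 ≤ c I) →
      HasSupport n (∑ I ∈ S, c I • simplexFace n I)
        (∑ I ∈ S, c I • fun J => if I ⊆ J then 1 else 0) := by
    intro c hc
    refine HasSupport.sum S fun I hI => ?_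
    have := Finset.mem_filter.1 hI
    exact (hasSupport_simplexFace (Finset.mem_powerset.1 this.1) this.2).smul (hc I)
  have hcc : ∀ c : Finset ℕ → ℝ, Convex ℝ (∑ I ∈ S, c I • simplexFace n I) ∧
      IsCompact (∑ I ∈ S, c I • simplexFace n I) := fun c =>
    convex_isCompact_sum S fun I _ =>
      ⟨(convex_simplexFace n I).smul _, (isCompact_simplexFace n I).smul _⟩
  have hval : ∀ c : Finset ℕ → ℝ, ∀ J ⊆ Finset.Icc 1 n,
      (∑ I ∈ S, c I • fun J => if I ⊆ J then (1 : ℝ) else 0) J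
        = ∑ I ∈ J.powerset with I.Nonempty, c I := by
    intro c J hJ
    rw [Finset.sum_apply]
    simp only [Pi.smul_apply, smul_eq_mul, mul_ite, mul_one, mul_zero]
    rw [← Finset.sum_filter]
    refine Finset.sum_congr ?_ fun _ _ => rfl
    ext I
    simp only [S, Finset.mem_filter, Finset.mem_powerset]
    exact ⟨fun h => ⟨h.2, h.1.2⟩, fun h => ⟨⟨h.1.trans hJ, h.2⟩, h.1⟩⟩
  have hneg := hsup (fun I => max (-y I) 0) fun I => le_max_right _ _
  have hpos := hsup (fun I => max (y I) 0) fun I => le_max_right _ _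
  have hsplit : ∀ J : Finset ℕ, ∑ I ∈ J.powerset with I.Nonempty, y I
      = ∑ I ∈ J.powerset with I.Nonempty, max (y I) 0
        - ∑ I ∈ J.powerset with I.Nonempty, max (-y I) 0 := by
    intro J
    rw [← Finset.sum_sub_distrib]
    refine Finset.sum_congr rfl fun I _ => ?_
    rcases le_total (y I) 0 with h | h
    · rw [max_eq_right h, max_eq_left (by linarith)]; ring
    · rw [max_eq_left h, max_eq_right (by linarith)]; ring
  constructor
  · intro h J hJ
    have h1 := hP.add hneg
    -- One set now has two support functions, and these must agree.
    rw [show P + _ = _ from h] at h1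
    have h2 := h1.unique hpos hJ
    rw [Pi.add_apply, hval _ J hJ, hval _ J hJ] at h2
    rw [hsplit]
    linarith
  · intro h
    refine (hP.add hneg).set_eq (hconv.add (hcc _).1) (hclosed.add_right_of_isCompact (hcc _).2)
      hpos (hcc _).1 (hcc _).2.isClosed fun J hJ => ?_
    rw [Pi.add_apply, hval _ J hJ, hval _ J hJ, ← h J hJ, hsplit]
    ring

/-! ### Sums over the edges of increasing paths. -/

/-- The pairs of consecutive elements of `V`. -/
def consecutive (V : Finset ℕ) : Finset (ℕ × ℕ) :=
  (V ×ˢ V).filter fun e => e.1 < e.2 ∧ ∀ z ∈ V, ¬ (e.1 < z ∧ z < e.2)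

theorem mem_consecutive {V : Finset ℕ} {x y : ℕ} :
    (x, y) ∈ consecutive V ↔
      x ∈ V ∧ y ∈ V ∧ x < y ∧ ∀ z ∈ V, ¬ (x < z ∧ z < y) := by
  simp [consecutive, and_assoc]

/-- The sum of `f` over the pairs of consecutive elements of `V`. -/
def pathSum (f : ℕ → ℕ → ℝ) (V : Finset ℕ) : ℝ := ∑ e ∈ consecutive V, f e.1 e.2

theorem exists_consecutive {V : Finset ℕ} {l r m : ℕ} (hl : l ∈ V) (hr : r ∈ V) (hlm : l < m)
    (hmr : m < r) (hm : m ∉ V) : ∃ x y, (x, y) ∈ consecutive V ∧ x < m ∧ m < y := by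
  obtain ⟨x, hx, hxmax⟩ := Finset.exists_max_image (V.filter (· < m)) id
    ⟨l, Finset.mem_filter.2 ⟨hl, hlm⟩⟩
  obtain ⟨y, hy, hymin⟩ := Finset.exists_min_image (V.filter (m < ·)) id
    ⟨r, Finset.mem_filter.2 ⟨hr, hmr⟩⟩
  rw [Finset.mem_filter] at hx hy
  refine ⟨x, y, mem_consecutive.2 ⟨hx.1, hy.1, hx.2.trans hy.2, fun z hz h => ?_⟩, hx.2, hy.2⟩
  rcases lt_trichotomy z m with h1 | rfl | h1
  · exact absurd (hxmax z (Finset.mem_filter.2 ⟨hz, h1⟩)) (not_le.2 h.1)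
  · exact hm hz
  · exact absurd (hymin z (Finset.mem_filter.2 ⟨hz, h1⟩)) (not_le.2 h.2)

/-- A new vertex splits the one edge that passes over it and leaves all other edges alone. -/
theorem pathSum_insert (f : ℕ → ℕ → ℝ) {V : Finset ℕ} {x m y : ℕ}
    (hxy : (x, y) ∈ consecutive V) (hxm : x < m) (hmy : m < y) :
    pathSum f (insert m V) = pathSum f V - f x y + f x m + f m y := by
  have h := mem_consecutive.1 hxy
  have hm : m ∉ V := fun hm => h.2.2.2 m hm ⟨hxm, hmy⟩
  have hset : consecutive (insert m V)
      = insert (x, m) (insert (m, y) ((consecutive V).erase (x, y))) := by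
    ext ⟨u, v⟩
    simp only [Finset.mem_insert, Finset.mem_erase, mem_consecutive, Prod.mk.injEq, ne_eq]
    constructor
    · rintro ⟨hu, hv, huv, hz⟩
      by_cases hum : u = m
      · subst hum
        right; left
        refine ⟨rfl, ?_⟩
        have hvV : v ∈ V := hv.resolve_left (by omega)
        have h1 := hz y (Or.inr h.2.1)
        have h2 := h.2.2.2 v hvV
        omega
      by_cases hvm : v = m
      · subst hvm
        left
        refine ⟨?_, rfl⟩
        have huV : u ∈ V := hu.resolve_left (by omega)
        have h1 := hz x (Or.inr h.1)
        have h2 := h.2.2.2 u huV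
        omega
      · right; right
        refine ⟨?_, hu.resolve_left hum, hv.resolve_left hvm, huv, fun z hzV => hz z (Or.inr hzV)⟩
        rintro ⟨rfl, rfl⟩
        exact hz m (Or.inl rfl) ⟨hxm, hmy⟩
    · rintro (⟨rfl, rfl⟩ | ⟨rfl, rfl⟩ | ⟨hne, hu, hv, huv, hz⟩)
      · refine ⟨Or.inr h.1, Or.inl rfl, hxm, ?_⟩
        rintro z (rfl | hz) h1
        · omega
        · exact h.2.2.2 z hz ⟨h1.1, h1.2.trans hmy⟩
      · refine ⟨Or.inl rfl, Or.inr h.2.1, hmy, ?_⟩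
        rintro z (rfl | hz) h1
        · omega
        · exact h.2.2.2 z hz ⟨hxm.trans h1.1, h1.2⟩
      · refine ⟨Or.inr hu, Or.inr hv, huv, ?_⟩
        rintro z (rfl | hzV) h1
        · have a1 := hz x h.1
          have a2 := hz y h.2.1
          have a3 := h.2.2.2 u hu
          have a4 := h.2.2.2 v hv
          omega
        · exact hz z hzV h1
  have h1 : (m, y) ∉ (consecutive V).erase (x, y) := fun h' =>
    hm (mem_consecutive.1 (Finset.mem_of_mem_erase h')).1
  have h2 : (x, m) ∉ insert (m, y) ((consecutive V).erase (x, y)) := fun h' => by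
    rcases Finset.mem_insert.1 h' with h' | h'
    · rw [Prod.mk.injEq] at h'
      omega
    · exact hm (mem_consecutive.1 (Finset.mem_of_mem_erase h')).2.1
  rw [pathSum, hset, Finset.sum_insert h2, Finset.sum_insert h1, pathSum,
    ← Finset.sum_erase_add _ _ hxy]
  ring

theorem pathSum_pair (f : ℕ → ℕ → ℝ) {l r : ℕ} (h : l < r) : pathSum f {l, r} = f l r := by
  have : consecutive {l, r} = {(l, r)} := by
    ext ⟨u, v⟩
    simp only [mem_consecutive, Finset.mem_insert, Finset.mem_singleton, Prod.mk.injEq]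
    constructor
    · rintro ⟨hu, hv, huv, -⟩
      omega
    · rintro ⟨rfl, rfl⟩
      refine ⟨Or.inl rfl, Or.inr rfl, h, ?_⟩
      rintro z (rfl | rfl) <;> omega
  rw [pathSum, this, Finset.sum_singleton]

/-- The path sum of a function whose change under the insertion of `m` only depends on `m`. -/
theorem pathSum_of_defect (f : ℕ → ℕ → ℝ) (c : ℕ → ℝ) {l r : ℕ} (hlr : l < r) (W : Finset ℕ)
    (hW : W ⊆ Finset.Ioo l r)
    (hf : ∀ x m y, l ≤ x → x < m → m < y → y ≤ r → f x m + f m y - f x y = c m) :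
    pathSum f ({l, r} ∪ W) = f l r + ∑ m ∈ W, c m := by
  induction W using Finset.induction_on with
  | empty => simp [pathSum_pair f hlr]
  | insert m W hm ih =>
    have hmr := Finset.mem_Ioo.1 (hW (Finset.mem_insert_self m W))
    have hW' : W ⊆ Finset.Ioo l r := (Finset.subset_insert m W).trans hW
    have hbd : ∀ z ∈ ({l, r} ∪ W : Finset ℕ), l ≤ z ∧ z ≤ r := by
      intro z hz
      simp only [Finset.mem_union, Finset.mem_insert, Finset.mem_singleton] at hz
      rcases hz with (rfl | rfl) | hz
      · omega
      · omega
      · have := Finset.mem_Ioo.1 (hW' hz)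
        omega
    obtain ⟨x, y, hxy, hxm, hmy⟩ := exists_consecutive (V := {l, r} ∪ W) (l := l) (r := r)
      (m := m) (by simp) (by simp) hmr.1 hmr.2 (by
        simp only [Finset.mem_union, Finset.mem_insert, Finset.mem_singleton, not_or]
        exact ⟨⟨by omega, by omega⟩, hm⟩)
    have h := mem_consecutive.1 hxy
    rw [Finset.union_insert, pathSum_insert f hxy hxm hmy, ih hW', Finset.sum_insert hm,
      ← hf x m y (hbd x h.1).1 hxm hmy (hbd y h.2.1).2]
    ring

/-- The second difference of a path sum. -/
theorem pathSum_second_difference (f : ℕ → ℕ → ℝ) {V : Finset ℕ} {l r i j : ℕ} (hl : l ∈ V)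
    (hr : r ∈ V) (hli : l < i) (hij : i < j) (hjr : j < r) (hi : i ∉ V) (hj : j ∉ V) :
    pathSum f (insert i (insert j V)) + pathSum f V = pathSum f (insert i V) + pathSum f (insert j V)
    ∨ ∃ x ∈ V, ∃ y ∈ V, x < i ∧ j < y ∧
      pathSum f (insert i (insert j V)) + pathSum f V
        = pathSum f (insert i V) + pathSum f (insert j V) + (f i j + f x y - f i y - f x j) := by
  obtain ⟨x, y, hxy, hxi, hiy⟩ := exists_consecutive hl hr hli (hij.trans hjr) hi
  obtain ⟨u, v, huv, huj, hjv⟩ := exists_consecutive hl hr (hli.trans hij) hjr hj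
  have h := mem_consecutive.1 hxy
  have h' := mem_consecutive.1 huv
  -- Two insertions interact only when `i` and `j` fall under the same edge.
  rcases lt_or_ge j y with hjy | hyj
  · right
    have hu : u = x := by
      have := h.2.2.2 u h'.1
      have := h'.2.2.2 x h.1
      omega
    have hv : v = y := by
      have := h.2.2.2 v h'.2.1
      have := h'.2.2.2 y h.2.1
      omega
    subst hu hv
    have hc : (u, j) ∈ consecutive (insert j V) := by
      refine mem_consecutive.2 ⟨Finset.mem_insert_of_mem h.1, Finset.mem_insert_self j V, huj, ?_⟩
      intro z hz hz'
      rcases Finset.mem_insert.1 hz with rfl | hz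
      · omega
      · exact h.2.2.2 z hz ⟨hz'.1, hz'.2.trans hjv⟩
    refine ⟨u, h.1, v, h.2.1, hxi, hjv, ?_⟩
    rw [pathSum_insert f hc hxi hij, pathSum_insert f hxy hxi hiy]
    ring
  · left
    have hc : (x, y) ∈ consecutive (insert j V) := by
      refine mem_consecutive.2 ⟨Finset.mem_insert_of_mem h.1, Finset.mem_insert_of_mem h.2.1,
        h.2.2.1, ?_⟩
      intro z hz hz'
      rcases Finset.mem_insert.1 hz with rfl | hz
      · omega
      · exact h.2.2.2 z hz hz'
    rw [pathSum_insert f hc hxi hiy, pathSum_insert f hxy hxi hiy]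
    ring

/-! ### Positions on the polygon and the sets `R`. -/

/-- The position of the label `x` as a starting point: the position of a down element, and the
position minus `n + 2` of an up element. -/
def startPos (n : ℕ) (Up : Finset ℕ) (x : ℕ) : ℤ :=
  if x ∈ Up then -((Up.filter fun u => u ≤ x).card : ℤ)
  else ((Do n Up).filter fun d => d ≤ x).card

/-- The position of the label `y ≠ 0`. -/
def endPos (n : ℕ) (Up : Finset ℕ) (y : ℕ) : ℤ :=
  if y ∈ Up then (n : ℤ) + 2 - (Up.filter fun u => u ≤ y).card
  else 1 + ((Do n Up).filter fun d => d < y).card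

section Polygon

variable {n : ℕ} {Up : Finset ℕ}

theorem mem_Do {i : ℕ} : i ∈ Do n Up ↔ (1 ≤ i ∧ i ≤ n) ∧ i ∉ Up := by
  simp [Do]

theorem card_Up_add_card_Do (hUp : Up ⊆ Finset.Ioo 1 n) : Up.card + (Do n Up).card = n := by
  have h : Up ⊆ Finset.Icc 1 n := hUp.trans Finset.Ioo_subset_Icc_self
  rw [Do, Finset.card_sdiff_of_subset h, Nat.card_Icc]
  have := Finset.card_le_card h
  rw [Nat.card_Icc] at this
  omega

theorem startPos_nonneg {x : ℕ} (hx : x ∉ Up) : 0 ≤ startPos n Up x := by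
  rw [startPos, if_neg hx]
  omega

theorem startPos_neg {x : ℕ} (hx : x ∈ Up) : startPos n Up x < 0 := by
  rw [startPos, if_pos hx]
  have : 0 < (Up.filter fun u => u ≤ x).card :=
    Finset.card_pos.2 ⟨x, Finset.mem_filter.2 ⟨hx, le_rfl⟩⟩
  omega

theorem endPos_pos (hUp : Up ⊆ Finset.Ioo 1 n) (y : ℕ) : 0 < endPos n Up y := by
  rw [endPos]
  have h1 := Finset.card_filter_le Up (fun u => u ≤ y)
  have h2 := card_Up_add_card_Do hUp
  split_ifs <;> omega

theorem endPos_lt (hUp : Up ⊆ Finset.Ioo 1 n) (y : ℕ) : endPos n Up y < n + 2 := by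
  rw [endPos]
  split_ifs with h
  · have : 0 < (Up.filter fun u => u ≤ y).card :=
      Finset.card_pos.2 ⟨y, Finset.mem_filter.2 ⟨h, le_rfl⟩⟩
    omega
  · have h1 := Finset.card_filter_le (Do n Up) (fun d => d < y)
    have h2 := card_Up_add_card_Do hUp
    omega

theorem startPos_zero (hUp : Up ⊆ Finset.Ioo 1 n) : startPos n Up 0 = 0 := by
  have h : 0 ∉ Up := fun h => by simpa using hUp h
  rw [startPos, if_neg h, Finset.filter_false_of_mem]
  · simp
  · intro d hd
    have := mem_Do.1 hd
    omega

theorem endPos_eq_startPos {x : ℕ} (h1 : 1 ≤ x) (hn : x ≤ n) :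
    endPos n Up x = startPos n Up x + if x ∈ Up then (n : ℤ) + 2 else 0 := by
  rw [endPos, startPos]
  split_ifs with h
  · ring
  · have : ((Do n Up).filter fun d => d ≤ x) = insert x ((Do n Up).filter fun d => d < x) := by
      ext i
      simp only [Finset.mem_filter, Finset.mem_insert, mem_Do]
      constructor
      · rintro ⟨hi, hix⟩
        rcases hix.eq_or_lt with rfl | hlt
        · exact Or.inl rfl
        · exact Or.inr ⟨hi, hlt⟩
      · rintro (rfl | ⟨hi, hix⟩)
        · exact ⟨⟨⟨h1, hn⟩, h⟩, le_rfl⟩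
        · exact ⟨hi, hix.le⟩
    rw [this, Finset.card_insert_of_notMem (by simp)]
    push_cast
    ring

/-- Only the type of the later label matters for `startPos`, and only that of the earlier label for
`endPos`. These comparisons fix the signs of the two factors in the supermodularity proof. -/
theorem startPos_lt_of_notMem {x i : ℕ} (hxi : x < i) (hi : i ≤ n) (hiU : i ∉ Up) :
    startPos n Up x < startPos n Up i := by
  by_cases hx : x ∈ Up
  · exact (startPos_neg hx).trans_le (startPos_nonneg hiU)
  · rw [startPos, startPos, if_neg hx, if_neg hiU, Nat.cast_lt]
    refine Finset.card_lt_card ?_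
    rw [Finset.ssubset_iff_of_subset]
    · exact ⟨i, Finset.mem_filter.2 ⟨mem_Do.2 ⟨by omega, hiU⟩, le_rfl⟩, by simp [hxi]⟩
    · intro d hd
      rw [Finset.mem_filter] at hd ⊢
      exact ⟨hd.1, by omega⟩

theorem startPos_lt_of_mem {x i : ℕ} (hxi : x < i) (hiU : i ∈ Up) :
    startPos n Up i < startPos n Up x := by
  by_cases hx : x ∈ Up
  · rw [startPos, startPos, if_pos hx, if_pos hiU, neg_lt_neg_iff, Nat.cast_lt]
    refine Finset.card_lt_card ?_
    rw [Finset.ssubset_iff_of_subset]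
    · exact ⟨i, Finset.mem_filter.2 ⟨hiU, le_rfl⟩, by simp [hxi]⟩
    · intro d hd
      rw [Finset.mem_filter] at hd ⊢
      exact ⟨hd.1, by omega⟩
  · exact (startPos_neg hiU).trans_le (startPos_nonneg hx)

theorem endPos_lt_of_mem (hUp : Up ⊆ Finset.Ioo 1 n) {j y : ℕ} (hjy : j < y) (hy : y ≤ n + 1)
    (hj : j ∈ Up) : endPos n Up y < endPos n Up j := by
  have hj' := Finset.mem_Ioo.1 (hUp hj)
  by_cases hyU : y ∈ Up
  · have hy' := Finset.mem_Ioo.1 (hUp hyU)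
    rw [endPos_eq_startPos (x := y) (by omega) (by omega),
      endPos_eq_startPos (x := j) (by omega) (by omega), if_pos hj, if_pos hyU]
    have := startPos_lt_of_mem (n := n) hjy hyU
    omega
  · rw [endPos, endPos, if_pos hj, if_neg hyU]
    have h1 := card_Up_add_card_Do hUp
    have h2 := Finset.card_filter_le Up (fun u => u ≤ j)
    have h3 := Finset.card_filter_add_card_filter_not (s := Do n Up) (fun d => d < y)
    have h4 := Finset.card_filter_le (Do n Up) (fun d => d < y)
    by_cases hyn : y = n + 1
    · omega
    · have : 0 < ((Do n Up).filter fun d => ¬ d < y).card :=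
        Finset.card_pos.2 ⟨y, Finset.mem_filter.2 ⟨mem_Do.2 ⟨by omega, hyU⟩, by omega⟩⟩
      omega

theorem endPos_lt_of_notMem (hUp : Up ⊆ Finset.Ioo 1 n) {j y : ℕ} (h1 : 1 ≤ j) (hjy : j < y)
    (hy : y ≤ n + 1) (hj : j ∉ Up) : endPos n Up j < endPos n Up y := by
  by_cases hyU : y ∈ Up
  · have hy' := Finset.mem_Ioo.1 (hUp hyU)
    rw [endPos, endPos, if_neg hj, if_pos hyU]
    have h1 := card_Up_add_card_Do hUp
    have h2 := Finset.card_filter_le Up (fun u => u ≤ y)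
    have h3 := Finset.card_filter_add_card_filter_not (s := Do n Up) (fun d => d < j)
    have : 0 < ((Do n Up).filter fun d => ¬ d < j).card :=
      Finset.card_pos.2 ⟨j, Finset.mem_filter.2 ⟨mem_Do.2 ⟨by omega, hj⟩, by omega⟩⟩
    omega
  · rw [endPos, endPos, if_neg hj, if_neg hyU]
    have : ((Do n Up).filter fun d => d < j).card < ((Do n Up).filter fun d => d < y).card := by
      refine Finset.card_lt_card ?_
      rw [Finset.ssubset_iff_of_subset]
      · exact ⟨j, Finset.mem_filter.2 ⟨mem_Do.2 ⟨by omega, hj⟩, hjy⟩, by simp⟩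
      · intro d hd
        rw [Finset.mem_filter] at hd ⊢
        exact ⟨hd.1, by omega⟩
    omega

theorem pos_eq_endPos (hUp : Up ⊆ Finset.Ioo 1 n) {y : ℕ} (h1 : 1 ≤ y) (hy : y ≤ n + 1) :
    (pos n Up y : ℤ) = endPos n Up y := by
  rw [pos, endPos]
  split_ifs with h
  · have h1 := Finset.card_filter_le Up (fun u => u ≤ y)
    have h2 := card_Up_add_card_Do hUp
    omega
  · have : ((DoBar n Up).filter fun d => d < y) = insert 0 ((Do n Up).filter fun d => d < y) := by
      ext i
      simp only [DoBar, Finset.mem_filter, Finset.mem_insert, Finset.mem_union,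
        Finset.mem_singleton]
      constructor
      · rintro ⟨hi | rfl | rfl, hiy⟩
        · exact Or.inr ⟨hi, hiy⟩
        · exact Or.inl rfl
        · omega
      · rintro (rfl | hi)
        · exact ⟨Or.inr (Or.inl rfl), by omega⟩
        · exact ⟨Or.inl hi.1, hi.2⟩
    rw [this, Finset.card_insert_of_notMem (by simp [mem_Do])]
    push_cast
    ring

theorem pos_zero (hUp : Up ⊆ Finset.Ioo 1 n) : pos n Up 0 = 0 := by
  have h : 0 ∉ Up := fun h => by simpa using hUp h
  rw [pos, if_neg h]
  simp

theorem pos_eq_startPos (hUp : Up ⊆ Finset.Ioo 1 n) {x : ℕ} (hx : x ≤ n) :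
    (pos n Up x : ℤ) = startPos n Up x + if x ∈ Up then (n : ℤ) + 2 else 0 := by
  rcases Nat.eq_zero_or_pos x with rfl | h
  · have h : 0 ∉ Up := fun h => by simpa using hUp h
    rw [pos_zero hUp, startPos_zero hUp, if_neg h]
    simp
  · rw [pos_eq_endPos hUp h (by omega), endPos_eq_startPos h hx]

theorem startPos_lt_endPos (hUp : Up ⊆ Finset.Ioo 1 n) {x y : ℕ} (hxy : x < y) (hy : y ≤ n + 1) :
    startPos n Up x < endPos n Up y ∧ endPos n Up y < startPos n Up x + (n + 2) := by
  have h1 := endPos_pos hUp y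
  have h2 := endPos_lt hUp y
  rcases Nat.eq_zero_or_pos x with rfl | hx
  · rw [startPos_zero hUp]
    omega
  have h3 := endPos_eq_startPos (Up := Up) hx (show x ≤ n by omega)
  by_cases hxU : x ∈ Up
  · have h4 := endPos_lt_of_mem hUp hxy hy hxU
    have h5 := startPos_neg (n := n) hxU
    rw [if_pos hxU] at h3
    omega
  · have h4 := endPos_lt_of_notMem hUp hx hxy hy hxU
    have h5 := startPos_nonneg (n := n) hxU
    rw [if_neg hxU] at h3
    omega

/-- Lowering the position of an up starting point by a full turn removes the reduction modulo `n +
2`. -/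
theorem ccw_eq (hUp : Up ⊆ Finset.Ioo 1 n) {x y : ℕ} (hxy : x < y) (hy : y ≤ n + 1) :
    (ccw n Up x y : ℤ) = endPos n Up y - startPos n Up x := by
  have h1 := pos_eq_endPos hUp (show 1 ≤ y by omega) hy
  have h2 := pos_eq_startPos hUp (show x ≤ n by omega)
  have h3 := startPos_lt_endPos hUp hxy hy
  rw [ccw]
  split_ifs at h2 with hx
  · rw [Nat.mod_eq_of_lt (by omega)]
    omega
  · have : pos n Up y + (n + 2) - pos n Up x = (pos n Up y - pos n Up x) + (n + 2) := by omega
    rw [this, Nat.add_mod_right, Nat.mod_eq_of_lt (by omega)]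
    omega

theorem ccw_swap_eq (hUp : Up ⊆ Finset.Ioo 1 n) {x y : ℕ} (hxy : x < y) (hy : y ≤ n + 1) :
    (ccw n Up y x : ℤ) = n + 2 - (endPos n Up y - startPos n Up x) := by
  have h1 := pos_eq_endPos hUp (show 1 ≤ y by omega) hy
  have h2 := pos_eq_startPos hUp (show x ≤ n by omega)
  have h3 := startPos_lt_endPos hUp hxy hy
  rw [ccw]
  split_ifs at h2 with hx
  · have : pos n Up x + (n + 2) - pos n Up y = (pos n Up x - pos n Up y) + (n + 2) := by omega
    rw [this, Nat.add_mod_right, Nat.mod_eq_of_lt (by omega)]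
    omega
  · rw [Nat.mod_eq_of_lt (by omega)]
    omega

theorem ccw_self (x : ℕ) (hx : pos n Up x ≤ n + 2) : ccw n Up x x = 0 := by
  rw [ccw]
  have : pos n Up x + (n + 2) - pos n Up x = n + 2 := by omega
  rw [this, Nat.mod_self]

/-- For `x < t` this is a comparison of end positions of `t` and `y`; for `t < x` the length from
`x` to `t` comes from `ccw_swap_eq`. -/
theorem mem_arc_iff (hUp : Up ⊆ Finset.Ioo 1 n) {x y t : ℕ} (hxy : x < y) (hy : y ≤ n + 1)
    (ht1 : 1 ≤ t) (htn : t ≤ n) :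
    t ∈ arc n Up x y ↔
      if t ∈ Up then (x ∈ Up ∧ t < x) ∨ (y ∈ Up ∧ y < t)
      else (x ∈ Up ∨ x < t) ∧ (y ∈ Up ∨ t < y) := by
  have hr : t < n + 2 := by omega
  have h1 := ccw_eq hUp hxy hy
  have hty := startPos_lt_endPos hUp hxy hy
  simp only [arc, Finset.mem_filter, Finset.mem_range, hr, true_and]
  have het := endPos_eq_startPos (Up := Up) ht1 htn
  rcases lt_trichotomy t x with htx | rfl | hxt
  · have h2 := ccw_swap_eq hUp htx (by omega)
    have h3 := endPos_eq_startPos (Up := Up) (show 1 ≤ x by omega) (show x ≤ n by omega)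
    have h4 := startPos_lt_endPos hUp htx (by omega)
    have h5 := startPos_lt_endPos hUp (htx.trans hxy) hy
    have h6 := endPos_lt hUp y
    by_cases htU : t ∈ Up
    · rw [if_pos htU] at het ⊢
      have h7 := endPos_lt_of_mem hUp (htx.trans hxy) hy htU
      by_cases hxU : x ∈ Up
      · rw [if_pos hxU] at h3
        simp only [hxU, htx, true_and, true_or, iff_true]
        omega
      · rw [if_neg hxU] at h3
        simp only [hxU, false_and, false_or, show ¬ y < t by omega, and_false, iff_false]
        omega
    · rw [if_neg htU] at het ⊢
      have h7 := startPos_nonneg (n := n) htU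
      by_cases hxU : x ∈ Up
      · rw [if_pos hxU] at h3
        simp only [hxU, htx.trans hxy, or_true, true_or, true_and, iff_true]
        omega
      · rw [if_neg hxU] at h3
        simp only [hxU, show ¬ x < t by omega, false_or, false_and, iff_false]
        omega
  · have h2 := endPos_lt hUp t
    have h3 := pos_eq_endPos hUp ht1 (by omega)
    rw [ccw_self t (by omega)]
    have h4 : ¬ y < t := by omega
    by_cases hxU : t ∈ Up <;> simp [hxU, h4]
  · have h2 := ccw_eq hUp hxt (by omega)
    have h4 := startPos_lt_endPos hUp hxt (by omega)
    have hiff : (0 < ccw n Up x t ∧ ccw n Up x t < ccw n Up x y) ↔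
        endPos n Up t < endPos n Up y := by omega
    rw [hiff]
    rcases lt_trichotomy t y with hlt | rfl | hlt
    · by_cases htU : t ∈ Up
      · have := endPos_lt_of_mem hUp hlt hy htU
        simp only [htU, if_true, show ¬ t < x by omega, show ¬ y < t by omega, and_false, or_self,
          iff_false]
        omega
      · have := endPos_lt_of_notMem hUp ht1 hlt hy htU
        simp [htU, hxt, hlt, this]
    · have h5 : ¬ t < x := by omega
      by_cases htU : t ∈ Up <;> simp [htU, h5]
    · by_cases hyU : y ∈ Up
      · have := endPos_lt_of_mem hUp hlt (by omega) hyU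
        by_cases htU : t ∈ Up <;> simp [htU, hyU, hxt, hlt, this]
      · have := endPos_lt_of_notMem hUp (by omega) hlt (by omega) hyU
        have h5 : ¬ t < x := by omega
        have h6 : ¬ t < y := by omega
        have h7 : ¬ endPos n Up t < endPos n Up y := by omega
        by_cases htU : t ∈ Up <;> simp [htU, hyU, h5, h6, h7]

theorem zero_mem_arc (hUp : Up ⊆ Finset.Ioo 1 n) {x y : ℕ} (hxy : x < y) (hy : y ≤ n + 1)
    (hx : x ∈ Up) : 0 ∈ arc n Up x y := by
  have hx' := Finset.mem_Ioo.1 (hUp hx)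
  have h1 := ccw_eq hUp hxy hy
  have h2 := ccw_swap_eq hUp (show 0 < x by omega) (by omega)
  have h3 := endPos_eq_startPos (Up := Up) (show 1 ≤ x by omega) (show x ≤ n by omega)
  have h4 := endPos_pos hUp y
  have h5 := startPos_neg (n := n) hx
  rw [startPos_zero hUp] at h2
  rw [if_pos hx] at h3
  simp only [arc, Finset.mem_filter, Finset.mem_range]
  omega

theorem succ_mem_arc (hUp : Up ⊆ Finset.Ioo 1 n) {x y : ℕ} (hxy : x < y)
    (hyU : y ∈ Up) : n + 1 ∈ arc n Up x y := by
  have hy := Finset.mem_Ioo.1 (hUp hyU)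
  have h1 := ccw_eq hUp hxy (by omega)
  have h2 := ccw_eq hUp (show x < n + 1 by omega) le_rfl
  have h3 := startPos_lt_endPos hUp (show x < n + 1 by omega) le_rfl
  have h4 := endPos_lt_of_mem hUp (show y < n + 1 by omega) le_rfl hyU
  simp only [arc, Finset.mem_filter, Finset.mem_range]
  omega

/-- The replacement rule for `0` and `n + 1` makes the inequalities at up end points weak; those two
labels automatically lie on the arc when the corresponding end point is up. -/
theorem mem_R_iff (hUp : Up ⊆ Finset.Ioo 1 n) {x y i : ℕ} (hxy : x < y) (hy : y ≤ n + 1) :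
    i ∈ R n Up x y ↔ (1 ≤ i ∧ i ≤ n) ∧
      if i ∈ Up then (x ∈ Up ∧ i ≤ x) ∨ (y ∈ Up ∧ y ≤ i)
      else (x ∈ Up ∨ x < i) ∧ (y ∈ Up ∨ i < y) := by
  have hUp' : ∀ u ∈ Up, 1 < u ∧ u < n := fun u hu => Finset.mem_Ioo.1 (hUp hu)
  have hlt : i ∈ arc n Up x y → i < n + 2 := fun h =>
    Finset.mem_range.1 (Finset.mem_filter.1 h).1
  have h1 : (i ∈ if 0 ∈ arc n Up x y ∧ x ∈ Up then ({x} : Finset ℕ) else ∅) ↔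
      x ∈ Up ∧ i = x := by
    split_ifs with h
    · simp [h.2]
    · have : x ∉ Up := fun hx => h ⟨zero_mem_arc hUp hxy hy hx, hx⟩
      simp [this]
  have h2 : (i ∈ if n + 1 ∈ arc n Up x y ∧ y ∈ Up then ({y} : Finset ℕ) else ∅) ↔
      y ∈ Up ∧ i = y := by
    split_ifs with h
    · simp [h.2]
    · have : y ∉ Up := fun hx => h ⟨succ_mem_arc hUp hxy hx, hx⟩
      simp [this]
  rw [R, Finset.mem_union, Finset.mem_union, h1, h2, Finset.mem_sdiff]
  simp only [Finset.mem_insert, Finset.mem_singleton]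
  by_cases hi : 1 ≤ i ∧ i ≤ n
  · rw [mem_arc_iff hUp hxy hy hi.1 hi.2]
    by_cases hiU : i ∈ Up
    · simp only [hi, hiU, if_true, true_and]
      constructor
      · rintro ((⟨h | h, -⟩ | h) | h)
        · exact Or.inl ⟨h.1, h.2.le⟩
        · exact Or.inr ⟨h.1, h.2.le⟩
        · exact Or.inl ⟨h.1, h.2.le⟩
        · exact Or.inr ⟨h.1, h.2.ge⟩
      · rintro (⟨h, h'⟩ | ⟨h, h'⟩)
        · rcases h'.eq_or_lt with h' | h'
          · exact Or.inl (Or.inr ⟨h, h'⟩)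
          · exact Or.inl (Or.inl ⟨Or.inl ⟨h, h'⟩, by omega⟩)
        · rcases h'.eq_or_lt with h' | h'
          · exact Or.inr ⟨h, h'.symm⟩
          · exact Or.inl (Or.inl ⟨Or.inr ⟨h, h'⟩, by omega⟩)
    · simp only [hi, hiU, if_false, true_and]
      constructor
      · rintro ((h | ⟨h, rfl⟩) | ⟨h, rfl⟩)
        · exact h.1
        · exact absurd h hiU
        · exact absurd h hiU
      · intro h
        exact Or.inl (Or.inl ⟨h, by omega⟩)
  · refine iff_of_false ?_ fun h => hi h.1
    rintro ((h | ⟨h, rfl⟩) | ⟨h, rfl⟩)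
    · have := hlt h.1
      omega
    · have := hUp' _ h
      omega
    · have := hUp' _ h
      omega

theorem R_subset (hUp : Up ⊆ Finset.Ioo 1 n) {x y : ℕ} (hxy : x < y) (hy : y ≤ n + 1) :
    R n Up x y ⊆ Finset.Icc 1 n := fun _ hi =>
  Finset.mem_Icc.2 ((mem_R_iff hUp hxy hy).1 hi).1

theorem card_Up_filter (hUp : Up ⊆ Finset.Ioo 1 n) (P : ℕ → Prop) [DecidablePred P] :
    ((Up.filter P).card : ℤ) = ∑ i ∈ Finset.Icc 1 n, if i ∈ Up ∧ P i then 1 else 0 := by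
  rw [← Finset.sum_filter, Finset.sum_const, nsmul_eq_mul, mul_one]
  congr 2
  ext i
  simp only [Finset.mem_filter, Finset.mem_Icc]
  refine ⟨fun h => ⟨?_, h⟩, fun h => h.2⟩
  have := Finset.mem_Ioo.1 (hUp h.1)
  omega

theorem card_Do_filter (P : ℕ → Prop) [DecidablePred P] :
    (((Do n Up).filter P).card : ℤ) = ∑ i ∈ Finset.Icc 1 n, if i ∉ Up ∧ P i then 1 else 0 := by
  rw [← Finset.sum_filter, Finset.sum_const, nsmul_eq_mul, mul_one]
  congr 2
  ext i
  simp only [Finset.mem_filter, Finset.mem_Icc, mem_Do, and_assoc]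

/-- Both sides are sums of indicators over `[n]` that agree label by label. The right-hand side is
linear in the two positions, which makes edge defects quadratic. -/
theorem card_R (hUp : Up ⊆ Finset.Ioo 1 n) {x y : ℕ} (hxy : x < y) (hy : y ≤ n + 1) :
    ((R n Up x y).card : ℤ) = endPos n Up y - startPos n Up x - 1 := by
  have hR : ((R n Up x y).card : ℤ) = ∑ i ∈ Finset.Icc 1 n, if i ∈ R n Up x y then 1 else 0 := by
    rw [Finset.sum_boole, Finset.filter_mem_eq_inter,
      Finset.inter_eq_right.2 (R_subset hUp hxy hy)]
  have hn : (n : ℤ) = ∑ i ∈ Finset.Icc 1 n, 1 := by simp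
  have hone : ∀ z, z ∈ Up → (1 : ℤ) = ∑ i ∈ Finset.Icc 1 n, if i = z then 1 else 0 := by
    intro z hz
    have := Finset.mem_Ioo.1 (hUp hz)
    rw [Finset.sum_ite_eq', if_pos (Finset.mem_Icc.2 (by omega))]
  rw [hR, startPos, endPos]
  by_cases hyU : y ∈ Up
  -- The spare unit is charged to `y`, which belongs to `R` although the count of up labels up to
  -- `y` subtracts it.
  · have hn1 : (n : ℤ) + 1
        = ∑ i ∈ Finset.Icc 1 n, 1 + ∑ i ∈ Finset.Icc 1 n, if i = y then 1 else 0 := by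
      rw [← hn, ← hone y hyU]
    rw [if_pos hyU, show ∀ a b : ℤ, (n : ℤ) + 2 - a - b - 1 = n + 1 - a - b by intros; ring,
      card_Up_filter hUp, hn1]
    by_cases hxU : x ∈ Up
    · rw [if_pos hxU, card_Up_filter hUp, sub_neg_eq_add, ← Finset.sum_add_distrib,
        ← Finset.sum_sub_distrib, ← Finset.sum_add_distrib]
      refine Finset.sum_congr rfl fun i hi => ?_
      rw [Finset.mem_Icc] at hi
      simp only [mem_R_iff hUp hxy hy, hi, hxU, hyU]
      by_cases hiU : i ∈ Up
      · simp only [hiU]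
        simp
        split_ifs <;> omega
      · have : i ≠ y := by rintro rfl; exact hiU hyU
        simp [hiU, this]
    · rw [if_neg hxU, card_Do_filter, ← Finset.sum_add_distrib,
        ← Finset.sum_sub_distrib, ← Finset.sum_sub_distrib]
      refine Finset.sum_congr rfl fun i hi => ?_
      rw [Finset.mem_Icc] at hi
      simp only [mem_R_iff hUp hxy hy, hi, hxU, hyU]
      by_cases hiU : i ∈ Up
      · simp only [hiU]
        simp
        split_ifs <;> omega
      · have : i ≠ y := by rintro rfl; exact hiU hyU
        simp [hiU, this]
        split_ifs <;> omega
  · rw [if_neg hyU, show ∀ a b : ℤ, 1 + a - b - 1 = a - b by intros; ring, card_Do_filter]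
    by_cases hxU : x ∈ Up
    · rw [if_pos hxU, card_Up_filter hUp, sub_neg_eq_add, ← Finset.sum_add_distrib]
      refine Finset.sum_congr rfl fun i hi => ?_
      rw [Finset.mem_Icc] at hi
      simp only [mem_R_iff hUp hxy hy, hi, hxU, hyU]
      by_cases hiU : i ∈ Up <;> simp [hiU]
    · rw [if_neg hxU, card_Do_filter, ← Finset.sum_sub_distrib]
      refine Finset.sum_congr rfl fun i hi => ?_
      rw [Finset.mem_Icc] at hi
      simp only [mem_R_iff hUp hxy hy, hi, hxU, hyU]
      by_cases hiU : i ∈ Up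
      · simp [hiU]
      · simp [hiU]
        split_ifs <;> omega

end Polygon

/-! ### The support function of the associahedron. -/

/-- The triangular number `t (t + 1) / 2`. -/
noncomputable def tri (t : ℝ) : ℝ := t * (t + 1) / 2

/-- The difference of the right-hand sides for `[n]` and for the diagonal `{x, y}`. -/
noncomputable def edgeDefect (n : ℕ) (Up : Finset ℕ) (x y : ℕ) : ℝ :=
  tri n - tri ((endPos n Up y : ℝ) - startPos n Up x - 1)

/-- The labels on the path from `0` to `n + 1` that has the elements of `J` below or, in case of up
elements, on it. -/
def pathVerts (n : ℕ) (Up J : Finset ℕ) : Finset ℕ :=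
  {0, n + 1} ∪ (Do n Up \ J ∪ J ∩ Up)

/-- The minimum of the coordinate sum with index set `J` on the associahedron. -/
noncomputable def suppFun (n : ℕ) (Up J : Finset ℕ) : ℝ :=
  ((Do n Up \ J).card + 1) * tri n - pathSum (edgeDefect n Up) (pathVerts n Up J)

section Support

variable {n : ℕ} {Up : Finset ℕ}

theorem edgeDefect_eq (hUp : Up ⊆ Finset.Ioo 1 n) {x y : ℕ} (hxy : x < y) (hy : y ≤ n + 1) :
    edgeDefect n Up x y = tri n - tri (R n Up x y).card := by
  have : ((R n Up x y).card : ℝ) = (endPos n Up y : ℝ) - startPos n Up x - 1 := by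
    exact_mod_cast card_R hUp hxy hy
  rw [edgeDefect, this]

theorem pathVerts_inner_subset (hUp : Up ⊆ Finset.Ioo 1 n) (J : Finset ℕ) :
    Do n Up \ J ∪ J ∩ Up ⊆ Finset.Ioo 0 (n + 1) := by
  intro i hi
  rw [Finset.mem_union, Finset.mem_sdiff, Finset.mem_inter, mem_Do] at hi
  rw [Finset.mem_Ioo]
  rcases hi with h | h
  · omega
  · have := Finset.mem_Ioo.1 (hUp h.2)
    omega

theorem mem_pathVerts {J : Finset ℕ} {i : ℕ} : i ∈ pathVerts n Up J ↔
    (i = 0 ∨ i = n + 1) ∨ (((1 ≤ i ∧ i ≤ n) ∧ i ∉ Up) ∧ i ∉ J) ∨ i ∈ J ∧ i ∈ Up := by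
  simp [pathVerts, mem_Do, or_assoc]

theorem le_of_mem_pathVerts (hUp : Up ⊆ Finset.Ioo 1 n) {J : Finset ℕ} {i : ℕ}
    (h : i ∈ pathVerts n Up J) : i ≤ n + 1 := by
  rw [mem_pathVerts] at h
  rcases h with (h | h) | h | h
  · omega
  · omega
  · omega
  · have := Finset.mem_Ioo.1 (hUp h.2)
    omega

/-- Start with the single edge from `0` to `n + 1`, whose `R` is the down set. Inserting a down
vertex `m` adds the total plus `x_m`; inserting an up vertex subtracts `x_m`. Both are identities of
indicators, independent of the neighbours of `m`. -/
theorem sum_coordSum_compl (hUp : Up ⊆ Finset.Ioo 1 n) {J : Finset ℕ} (hJ : J ⊆ Finset.Icc 1 n)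
    (x : Finset.Icc 1 n → ℝ) :
    pathSum (fun d e => coordSum n x (Finset.Icc 1 n) - coordSum n x (R n Up d e))
      (pathVerts n Up J)
      = ((Do n Up \ J).card + 1) * coordSum n x (Finset.Icc 1 n) - coordSum n x J := by
  have hDo : Do n Up ⊆ Finset.Icc 1 n := Finset.sdiff_subset
  have hUp' : Up ⊆ Finset.Icc 1 n := hUp.trans Finset.Ioo_subset_Icc_self
  have hdisj : Disjoint (Do n Up \ J) (J ∩ Up) :=
    Finset.disjoint_of_subset_right Finset.inter_subset_left Finset.sdiff_disjoint
  rw [pathVerts, pathSum_of_defect _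
    (fun m => (if m ∈ Up then 0 else coordSum n x (Finset.Icc 1 n))
      + (if m ∈ Up then -coord n x m else coord n x m)) (Nat.succ_pos n) _
    (pathVerts_inner_subset hUp J), Finset.sum_union hdisj]
  · have h1 : R n Up 0 (n + 1) = Do n Up := by
      ext i
      have h0 : 0 ∉ Up := fun h => by simpa using hUp h
      have h1 : n + 1 ∉ Up := fun h => by simpa using hUp h
      rw [mem_R_iff hUp (Nat.succ_pos n) le_rfl, mem_Do]
      by_cases hi : i ∈ Up
      · simp [hi, h0, h1]
      · simp [hi, h0, h1]
        omega
    have h2 : ∑ m ∈ Do n Up \ J, ((if m ∈ Up then 0 else coordSum n x (Finset.Icc 1 n))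
        + (if m ∈ Up then -coord n x m else coord n x m))
        = (Do n Up \ J).card * coordSum n x (Finset.Icc 1 n)
          + ∑ m ∈ Do n Up \ J, coord n x m := by
      rw [← nsmul_eq_mul, ← Finset.sum_const, ← Finset.sum_add_distrib]
      refine Finset.sum_congr rfl fun m hm => ?_
      have := (mem_Do.1 (Finset.mem_sdiff.1 hm).1).2
      rw [if_neg this, if_neg this]
    have h3 : ∑ m ∈ J ∩ Up, ((if m ∈ Up then 0 else coordSum n x (Finset.Icc 1 n))
        + (if m ∈ Up then -coord n x m else coord n x m))
        = -∑ m ∈ J ∩ Up, coord n x m := by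
      rw [← Finset.sum_neg_distrib]
      refine Finset.sum_congr rfl fun m hm => ?_
      have := (Finset.mem_inter.1 hm).2
      rw [if_pos this, if_pos this, zero_add]
    have h4 : J = (Do n Up ∩ J) ∪ (J ∩ Up) := by
      ext i
      simp only [Finset.mem_union, Finset.mem_inter, mem_Do]
      have : i ∈ J → 1 ≤ i ∧ i ≤ n := fun h => Finset.mem_Icc.1 (hJ h)
      tauto
    have h5 : ∑ m ∈ J, coord n x m = ∑ m ∈ Do n Up ∩ J, coord n x m
        + ∑ m ∈ J ∩ Up, coord n x m := by
      conv_lhs => rw [h4]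
      refine Finset.sum_union ?_
      rw [Finset.disjoint_left]
      intro i hi hi'
      exact (mem_Do.1 (Finset.mem_inter.1 hi).1).2 (Finset.mem_inter.1 hi').2
    have h6 := Finset.sum_inter_add_sum_sdiff (Do n Up) J (coord n x)
    rw [h1, h2, h3, coordSum_eq_sum x hDo, coordSum_eq_sum x hJ]
    linarith
  · intro d m e _ hdm hme he
    have hRs := coordSum_eq_sum_Icc n x
    have hm : (1 ≤ m ∧ m ≤ n) := by omega
    have hcm : (if m ∈ Up then -coord n x m else coord n x m) =
        ∑ i ∈ Finset.Icc 1 n, if i = m then (if m ∈ Up then -coord n x i else coord n x i)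
          else 0 := by
      rw [Finset.sum_ite_eq', if_pos (Finset.mem_Icc.2 hm)]
    have h0 : (if m ∈ Up then 0 else coordSum n x (Finset.Icc 1 n)) =
        ∑ i ∈ Finset.Icc 1 n, if m ∈ Up then 0 else coord n x i := by
      split_ifs
      · simp
      · rw [coordSum_eq_sum x subset_rfl]
    rw [hcm, h0, coordSum_eq_sum x subset_rfl]
    simp only [hRs, ← Finset.sum_add_distrib, ← Finset.sum_sub_distrib]
    refine Finset.sum_congr rfl fun i hi => ?_
    rw [Finset.mem_Icc] at hi
    rw [if_congr (mem_R_iff hUp hdm (by omega)) rfl rfl, if_congr (mem_R_iff hUp hme he) rfl rfl,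
      if_congr (mem_R_iff hUp (hdm.trans hme) he) rfl rfl]
    have hdm' : ¬ m ≤ d := by omega
    have hme' : ¬ e ≤ m := by omega
    rcases lt_trichotomy i m with h | rfl | h
    · have a1 : ¬ m ≤ i := by omega
      have a2 : ¬ m < i := by omega
      have a3 : ¬ e ≤ i := by omega
      have a4 : i < e := by omega
      have a5 : i ≠ m := by omega
      by_cases hiU : i ∈ Up <;> by_cases hmU : m ∈ Up <;>
        simp only [hi, hiU, hmU, h, h.le, a1, a2, a3, a4, a5, and_true, and_false, true_and,
          or_true, or_false, if_true, if_false] <;>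
        (try split_ifs) <;> ring
    · by_cases hiU : i ∈ Up <;>
        simp only [hi, hiU, hdm, hme, hdm', hme', le_rfl, lt_irrefl, and_true, and_false,
          or_true, or_false, if_true, if_false] <;>
        ring
    · have a1 : ¬ i ≤ m := by omega
      have a2 : ¬ i < m := by omega
      have a3 : ¬ i ≤ d := by omega
      have a4 : d < i := by omega
      have a5 : i ≠ m := by omega
      by_cases hiU : i ∈ Up <;> by_cases hmU : m ∈ Up <;>
        simp only [hi, hiU, hmU, h, h.le, a1, a2, a3, a4, a5, and_true, and_false, true_and,
          or_true, or_false, false_or, if_true, if_false] <;>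
        (try split_ifs) <;> ring

/-- Measures the gap between `suppFun` and the coordinate sum by the slacks of the path's edges. It
needs only the total of `x`, so any such point also serves to evaluate `suppFun`. -/
theorem suppFun_eq (hUp : Up ⊆ Finset.Ioo 1 n) {J : Finset ℕ} (hJ : J ⊆ Finset.Icc 1 n)
    {x : Finset.Icc 1 n → ℝ} (hx : coordSum n x (Finset.Icc 1 n) = tri n) :
    suppFun n Up J = coordSum n x J + ∑ e ∈ consecutive (pathVerts n Up J),
      (tri (R n Up e.1 e.2).card - coordSum n x (R n Up e.1 e.2)) := by
  have h := sum_coordSum_compl hUp hJ x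
  rw [hx] at h
  have h1 : ∑ e ∈ consecutive (pathVerts n Up J),
      (tri (R n Up e.1 e.2).card - coordSum n x (R n Up e.1 e.2))
      = pathSum (fun d e => tri n - coordSum n x (R n Up d e)) (pathVerts n Up J)
        - pathSum (edgeDefect n Up) (pathVerts n Up J) := by
    rw [pathSum, pathSum, ← Finset.sum_sub_distrib]
    refine Finset.sum_congr rfl fun e he => ?_
    have he' := mem_consecutive.1 he
    rw [edgeDefect_eq hUp he'.2.2.1 (le_of_mem_pathVerts hUp he'.2.1)]
    ring
  rw [h1, suppFun]
  linarith

/-- A polygon edge has `R` empty or all of `[n]`, where the inequality is an equality; paths may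
therefore use edges as well as proper diagonals. -/
theorem tri_card_le_coordSum (hUp : Up ⊆ Finset.Ioo 1 n) {x : Finset.Icc 1 n → ℝ}
    (hx : x ∈ associahedron n Up) {d e : ℕ} (hde : d < e) (he : e ≤ n + 1) :
    tri (R n Up d e).card ≤ coordSum n x (R n Up d e) := by
  by_cases h : IsProperDiagonal n Up d e
  · exact hx.2 d e h
  have hcard := card_R hUp hde he
  have hccw := ccw_eq hUp hde he
  have hccw' := ccw_swap_eq hUp hde he
  have h1 : ccw n Up d e = 1 ∨ ccw n Up e d = 1 := by
    by_contra hne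
    rw [not_or] at hne
    exact h ⟨hde, he, hne.1, hne.2⟩
  rcases h1 with h1 | h1
  · have : R n Up d e = ∅ := Finset.card_eq_zero.1 (by omega)
    rw [this, coordSum_eq_sum x (Finset.empty_subset _)]
    simp [tri]
  · have : R n Up d e = Finset.Icc 1 n := by
      refine Finset.eq_of_subset_of_card_le (R_subset hUp hde he) ?_
      rw [Nat.card_Icc]
      omega
    rw [this, hx.1, Nat.card_Icc, tri]
    simp

theorem suppFun_le_coordSum (hUp : Up ⊆ Finset.Ioo 1 n) {x : Finset.Icc 1 n → ℝ}
    (hx : x ∈ associahedron n Up) {J : Finset ℕ} (hJ : J ⊆ Finset.Icc 1 n) :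
    suppFun n Up J ≤ coordSum n x J := by
  rw [suppFun_eq hUp hJ hx.1]
  have : ∑ e ∈ consecutive (pathVerts n Up J),
      (tri (R n Up e.1 e.2).card - coordSum n x (R n Up e.1 e.2)) ≤ 0 := by
    refine Finset.sum_nonpos fun e he => ?_
    have he' := mem_consecutive.1 he
    have := tri_card_le_coordSum hUp hx he'.2.2.1 (le_of_mem_pathVerts hUp he'.2.1)
    linarith
  linarith

theorem exists_coordSum_eq (hn : 1 ≤ n) (c : ℝ) :
    ∃ x : Finset.Icc 1 n → ℝ, coordSum n x (Finset.Icc 1 n) = c := by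
  have h1 : 1 ∈ Finset.Icc 1 n := Finset.mem_Icc.2 ⟨le_rfl, hn⟩
  refine ⟨c • Pi.single ⟨1, h1⟩ 1, ?_⟩
  rw [coordSum_smul, coordSum_single, if_pos h1, mul_one]

theorem coordSum_empty (x : Finset.Icc 1 n → ℝ) : coordSum n x ∅ = 0 := by
  rw [coordSum_eq_sum x (Finset.empty_subset _), Finset.sum_empty]

theorem tri_sub_eq_zero {x : Finset.Icc 1 n → ℝ} (hx : coordSum n x (Finset.Icc 1 n) = tri n)
    {S : Finset ℕ} (hS : S = ∅ ∨ S = Finset.Icc 1 n) : tri S.card - coordSum n x S = 0 := by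
  rcases hS with rfl | rfl
  · simp [tri, coordSum_empty]
  · simp [hx]

theorem R_eq_empty (hUp : Up ⊆ Finset.Ioo 1 n) {x y : ℕ} (hxy : x < y) (hy : y ≤ n + 1)
    (hxU : x ∉ Up) (hyU : y ∉ Up)
    (h : ∀ d, 1 ≤ d → d ≤ n → d ∉ Up → ¬ (x < d ∧ d < y)) : R n Up x y = ∅ := by
  rw [Finset.eq_empty_iff_forall_notMem]
  intro i hi
  rw [mem_R_iff hUp hxy hy] at hi
  by_cases hiU : i ∈ Up
  · simp [hiU, hxU, hyU] at hi
  · simp only [hiU, hxU, hyU, if_false, false_or] at hi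
    exact h i hi.1.1 hi.1.2 hiU hi.2

theorem R_eq_Icc (hUp : Up ⊆ Finset.Ioo 1 n) {x y : ℕ} (hxy : x < y) (hy : y ≤ n + 1)
    (hxU : x ∈ Up ∨ x = 0) (hyU : y ∈ Up ∨ y = n + 1)
    (h : ∀ u ∈ Up, ¬ (x < u ∧ u < y)) : R n Up x y = Finset.Icc 1 n := by
  refine (R_subset hUp hxy hy).antisymm fun i hi => ?_
  rw [mem_R_iff hUp hxy hy]
  rw [Finset.mem_Icc] at hi
  refine ⟨hi, ?_⟩
  by_cases hiU : i ∈ Up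
  · rw [if_pos hiU]
    have h1 := h i hiU
    rcases hxU with hxU | rfl
    · rcases hyU with hyU | rfl
      · simp only [hxU, hyU, true_and]
        omega
      · exact Or.inl ⟨hxU, by omega⟩
    · rcases hyU with hyU | rfl
      · exact Or.inr ⟨hyU, by omega⟩
      · omega
  · rw [if_neg hiU]
    constructor
    · exact hxU.imp_right fun h => by omega
    · exact hyU.imp_right fun h => by omega

/-- The path runs through all down labels, along polygon edges with empty `R`. -/
theorem suppFun_empty (hn : 1 ≤ n) (hUp : Up ⊆ Finset.Ioo 1 n) : suppFun n Up ∅ = 0 := by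
  obtain ⟨x, hx⟩ := exists_coordSum_eq hn (tri n)
  have h0 : 0 ∉ Up := fun h => by simpa using hUp h
  have h1 : n + 1 ∉ Up := fun h => by simpa using hUp h
  rw [suppFun_eq hUp (Finset.empty_subset _) hx, coordSum_empty, zero_add]
  refine Finset.sum_eq_zero fun e he => tri_sub_eq_zero hx (Or.inl ?_)
  obtain ⟨ha, hb, hab, hz⟩ := mem_consecutive.1 he
  have hV : ∀ i ∈ pathVerts n Up ∅, i ∉ Up := by
    intro i hi hiU
    rcases mem_pathVerts.1 hi with (rfl | rfl) | h | h
    · exact h0 hiU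
    · exact h1 hiU
    · exact h.1.2 hiU
    · simp at h
  refine R_eq_empty hUp hab (le_of_mem_pathVerts hUp hb) (hV _ ha) (hV _ hb) fun d hd1 hdn hdU => ?_
  exact hz d (mem_pathVerts.2 (Or.inr (Or.inl ⟨⟨⟨hd1, hdn⟩, hdU⟩, by simp⟩)))

theorem suppFun_Icc (hn : 1 ≤ n) (hUp : Up ⊆ Finset.Ioo 1 n) :
    suppFun n Up (Finset.Icc 1 n) = tri n := by
  obtain ⟨x, hx⟩ := exists_coordSum_eq hn (tri n)
  rw [suppFun_eq hUp subset_rfl hx, hx, Finset.sum_eq_zero, add_zero]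
  refine fun e he => tri_sub_eq_zero hx (Or.inr ?_)
  obtain ⟨ha, hb, hab, hz⟩ := mem_consecutive.1 he
  have hV : ∀ i ∈ pathVerts n Up (Finset.Icc 1 n), (i = 0 ∨ i = n + 1) ∨ i ∈ Up := by
    intro i hi
    rcases mem_pathVerts.1 hi with h | h | h
    · exact Or.inl h
    · exact absurd (Finset.mem_Icc.2 h.1.1) h.2
    · exact Or.inr h.2
  have hb' := le_of_mem_pathVerts hUp hb
  have ha1 := hV _ ha
  have hb1 := hV _ hb
  refine R_eq_Icc hUp hab hb' ?_ ?_ fun u hu => ?_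
  · rcases ha1 with (h | h) | h
    · exact Or.inr h
    · omega
    · exact Or.inl h
  · rcases hb1 with (h | h) | h
    · omega
    · exact Or.inr h
    · exact Or.inl h
  · refine hz u (mem_pathVerts.2 (Or.inr (Or.inr ⟨?_, hu⟩)))
    exact Finset.Ioo_subset_Icc_self (hUp hu)

/-- The path of `R` uses the edge from `x` to `y`, and every other edge has `R` empty or full and so
no slack. -/
theorem suppFun_R (hn : 1 ≤ n) (hUp : Up ⊆ Finset.Ioo 1 n) {x y : ℕ} (hxy : x < y)
    (hy : y ≤ n + 1) : suppFun n Up (R n Up x y) = tri (R n Up x y).card := by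
  obtain ⟨w, hw⟩ := exists_coordSum_eq hn (tri n)
  have h0 : 0 ∉ Up := fun h => by simpa using hUp h
  have h1 : n + 1 ∉ Up := fun h => by simpa using hUp h
  -- Up to `x` the path keeps the labels of the same type as `x`, from `y` on those of the type of
  -- `y`, and none in between.
  have hV : ∀ i, i ∈ pathVerts n Up (R n Up x y) ↔ (i = 0 ∨ i = n + 1) ∨ (1 ≤ i ∧ i ≤ n) ∧
      ((i ≤ x ∧ (i ∈ Up ↔ x ∈ Up)) ∨ (y ≤ i ∧ (i ∈ Up ↔ y ∈ Up))) := by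
    intro i
    rw [mem_pathVerts, mem_R_iff hUp hxy hy]
    refine or_congr_right ?_
    by_cases hi : 1 ≤ i ∧ i ≤ n
    · by_cases hiU : i ∈ Up
      · simp only [hi, hiU, true_and, if_true, not_true, and_false, false_and, false_or, and_true,
          true_iff]
        tauto
      · simp only [hi, hiU, true_and, if_false, not_false_iff, and_false, or_false, false_iff]
        rw [not_and_or, not_or, not_or, not_lt, not_lt]
        tauto
    · simp only [hi, false_and, or_self]
  have hxV : x ∈ pathVerts n Up (R n Up x y) := by
    rw [hV]
    rcases Nat.eq_zero_or_pos x with h | h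
    · exact Or.inl (Or.inl h)
    · exact Or.inr ⟨by omega, Or.inl ⟨le_rfl, Iff.rfl⟩⟩
  have hyV : y ∈ pathVerts n Up (R n Up x y) := by
    rw [hV]
    rcases hy.eq_or_lt with h | h
    · exact Or.inl (Or.inr h)
    · exact Or.inr ⟨by omega, Or.inr ⟨le_rfl, Iff.rfl⟩⟩
  have hc : (x, y) ∈ consecutive (pathVerts n Up (R n Up x y)) := by
    refine mem_consecutive.2 ⟨hxV, hyV, hxy, fun z hz h => ?_⟩
    rw [hV] at hz
    omega
  rw [suppFun_eq hUp (R_subset hUp hxy hy) hw, Finset.sum_eq_single_of_mem _ hc]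
  · ring
  rintro ⟨a, b⟩ he hne
  obtain ⟨ha, hb, hab, hz⟩ := mem_consecutive.1 he
  refine tri_sub_eq_zero hw ?_
  dsimp only
  have hb' := le_of_mem_pathVerts hUp hb
  have hzx := hz x hxV
  have hzy := hz y hyV
  have hcases : b ≤ x ∨ y ≤ a := by
    by_contra hcon
    refine hne ?_
    rw [Prod.mk.injEq]
    have := (mem_consecutive.1 hc).2.2.2 a ha
    have := (mem_consecutive.1 hc).2.2.2 b hb
    omega
  rw [hV] at ha hb
  rcases hcases with hbx | hya
  · have hb2 : b ∈ Up ↔ x ∈ Up := by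
      rcases hb with h | ⟨-, h | h⟩
      · omega
      · exact h.2
      · omega
    by_cases hxU : x ∈ Up
    · right
      refine R_eq_Icc hUp hab hb' ?_ (Or.inl (hb2.2 hxU)) fun u hu h => ?_
      · rcases ha with h | ⟨-, h | h⟩
        · omega
        · exact Or.inl (h.2.2 hxU)
        · omega
      · refine hz u ((hV u).2 (Or.inr ⟨by omega, Or.inl ⟨by omega, ?_⟩⟩)) h
        exact iff_of_true hu hxU
    · left
      refine R_eq_empty hUp hab hb' ?_ (fun h => hxU (hb2.1 h)) fun d hd1 hdn hdU h => ?_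
      · rcases ha with (rfl | h) | ⟨-, h | h⟩
        · exact h0
        · omega
        · exact fun h' => hxU (h.2.1 h')
        · omega
      · refine hz d ((hV d).2 (Or.inr ⟨by omega, Or.inl ⟨by omega, ?_⟩⟩)) h
        exact iff_of_false hdU hxU
  · have ha2 : a ∈ Up ↔ y ∈ Up := by
      rcases ha with h | ⟨-, h | h⟩
      · omega
      · omega
      · exact h.2
    by_cases hyU : y ∈ Up
    · right
      refine R_eq_Icc hUp hab hb' (Or.inl (ha2.2 hyU)) ?_ fun u hu h => ?_
      · rcases hb with h | ⟨-, h | h⟩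
        · omega
        · omega
        · exact Or.inl (h.2.2 hyU)
      · refine hz u ((hV u).2 (Or.inr ⟨by omega, Or.inr ⟨by omega, ?_⟩⟩)) h
        exact iff_of_true hu hyU
    · left
      refine R_eq_empty hUp hab hb' (fun h => hyU (ha2.1 h)) ?_ fun d hd1 hdn hdU h => ?_
      · rcases hb with (h | rfl) | ⟨-, h | h⟩
        · omega
        · exact h1
        · omega
        · exact fun h' => hyU (h.2.1 h')
      · refine hz d ((hV d).2 (Or.inr ⟨by omega, Or.inr ⟨by omega, ?_⟩⟩)) h
        exact iff_of_false hdU hyU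

theorem pathVerts_insert_of_mem {i : ℕ} (hi : i ∈ Up) (J : Finset ℕ) :
    pathVerts n Up (insert i J) = insert i (pathVerts n Up J) := by
  ext k
  rw [Finset.mem_insert, mem_pathVerts, mem_pathVerts, Finset.mem_insert]
  by_cases hk : k = i
  · subst hk
    simp [hi]
  · simp [hk]

theorem pathVerts_insert_of_notMem {i : ℕ} (hi : i ∈ Finset.Icc 1 n) (hiU : i ∉ Up) {J : Finset ℕ}
    (hiJ : i ∉ J) : pathVerts n Up J = insert i (pathVerts n Up (insert i J)) := by
  ext k
  rw [Finset.mem_insert, mem_pathVerts, mem_pathVerts, Finset.mem_insert]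
  rw [Finset.mem_Icc] at hi
  by_cases hk : k = i
  · subst hk
    simp [hi, hiU, hiJ]
  · simp [hk]

theorem card_Do_sdiff_insert {i : ℕ} (hi : i ∈ Finset.Icc 1 n) {J : Finset ℕ} (hiJ : i ∉ J) :
    ((Do n Up \ insert i J).card : ℝ) = (Do n Up \ J).card - if i ∈ Up then 0 else 1 := by
  rw [Finset.mem_Icc] at hi
  rw [Finset.sdiff_insert]
  split_ifs with hiU
  · rw [Finset.erase_eq_of_notMem, sub_zero]
    simp [mem_Do, hiU]
  · rw [Finset.card_erase_of_mem, Nat.cast_sub, Nat.cast_one]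
    · exact Finset.card_pos.2 ⟨i, by simp [mem_Do, hi, hiU, hiJ]⟩
    · simp [mem_Do, hi, hiU, hiJ]

/-- Only the product of the start and end position in the quadratic `tri` survives a mixed
difference. No order of the labels is needed, so the degenerate case `i = j` is available later. -/
theorem edgeDefect_second_difference (i j x y : ℕ) :
    edgeDefect n Up i j + edgeDefect n Up x y - edgeDefect n Up i y - edgeDefect n Up x j
      = ((endPos n Up j : ℝ) - endPos n Up y) * (startPos n Up i - startPos n Up x) := by
  simp only [edgeDefect, tri]
  ring

/-- Adding an up label to `J` inserts a path vertex, adding a down label deletes one. The second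
difference of the path sum changes sign when exactly one of `i`, `j` is down, and so does the
product from `edgeDefect_second_difference`. -/
theorem suppFun_supermodular_of_lt (hUp : Up ⊆ Finset.Ioo 1 n) {J : Finset ℕ} {i j : ℕ}
    (hi : i ∈ Finset.Icc 1 n) (hj : j ∈ Finset.Icc 1 n) (hij : i < j) (hiJ : i ∉ J) (hjJ : j ∉ J) :
    suppFun n Up (insert i J) + suppFun n Up (insert j J)
      ≤ suppFun n Up (insert i (insert j J)) + suppFun n Up J := by
  have hi' := Finset.mem_Icc.1 hi
  have hj' := Finset.mem_Icc.1 hj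
  have hi0 : i ∉ insert j J := by simp [hij.ne, hiJ]
  have hj0 : j ∉ insert i J := by simp [hij.ne', hjJ]
  have h0 : ∀ K, 0 ∈ pathVerts n Up K := fun K => mem_pathVerts.2 (Or.inl (Or.inl rfl))
  have h1 : ∀ K, n + 1 ∈ pathVerts n Up K := fun K => mem_pathVerts.2 (Or.inl (Or.inr rfl))
  have hmem : ∀ k ∈ Finset.Icc 1 n, ∀ K, k ∈ pathVerts n Up K ↔ (k ∉ Up ∧ k ∉ K) ∨ k ∈ K ∧ k ∈ Up := by
    intro k hk K
    have := Finset.mem_Icc.1 hk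
    rw [mem_pathVerts]
    constructor
    · rintro (h | h | h)
      · omega
      · exact Or.inl ⟨h.1.2, h.2⟩
      · exact Or.inr h
    · rintro (h | h)
      · exact Or.inr (Or.inl ⟨⟨this, h.1⟩, h.2⟩)
      · exact Or.inr (Or.inr h)
  have hP : ∀ {x y : ℕ}, x < i → j < y → y ≤ n + 1 →
      ((i ∈ Up ↔ j ∈ Up) → ((endPos n Up j : ℝ) - endPos n Up y) *
        (startPos n Up i - startPos n Up x) ≤ 0) ∧
      (¬ (i ∈ Up ↔ j ∈ Up) → 0 ≤ ((endPos n Up j : ℝ) - endPos n Up y) *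
        (startPos n Up i - startPos n Up x)) := by
    intro x y hx hy hyn
    by_cases hiU : i ∈ Up <;> by_cases hjU : j ∈ Up <;>
      simp only [hiU, hjU, iff_true, iff_false, not_true, not_false_iff, forall_true_left,
        IsEmpty.forall_iff, and_true, true_and]
    · have a : (startPos n Up i : ℝ) < startPos n Up x := by
        exact_mod_cast startPos_lt_of_mem hx hiU
      have b : (endPos n Up y : ℝ) < endPos n Up j := by
        exact_mod_cast endPos_lt_of_mem hUp hy hyn hjU
      exact mul_nonpos_of_nonneg_of_nonpos (by linarith) (by linarith)
    · have a : (startPos n Up i : ℝ) < startPos n Up x := by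
        exact_mod_cast startPos_lt_of_mem hx hiU
      have b : (endPos n Up j : ℝ) < endPos n Up y := by
        exact_mod_cast endPos_lt_of_notMem hUp hj'.1 hy hyn hjU
      exact mul_nonneg_of_nonpos_of_nonpos (by linarith) (by linarith)
    · have a : (startPos n Up x : ℝ) < startPos n Up i := by
        exact_mod_cast startPos_lt_of_notMem hx hi'.2 hiU
      have b : (endPos n Up y : ℝ) < endPos n Up j := by
        exact_mod_cast endPos_lt_of_mem hUp hy hyn hjU
      exact mul_nonneg (by linarith) (by linarith)
    · have a : (startPos n Up x : ℝ) < startPos n Up i := by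
        exact_mod_cast startPos_lt_of_notMem hx hi'.2 hiU
      have b : (endPos n Up j : ℝ) < endPos n Up y := by
        exact_mod_cast endPos_lt_of_notMem hUp hj'.1 hy hyn hjU
      exact mul_nonpos_of_nonpos_of_nonneg (by linarith) (by linarith)
  have hsd : ∀ K, i ∉ pathVerts n Up K → j ∉ pathVerts n Up K →
      ((i ∈ Up ↔ j ∈ Up) →
        pathSum (edgeDefect n Up) (insert i (insert j (pathVerts n Up K)))
          + pathSum (edgeDefect n Up) (pathVerts n Up K)
        ≤ pathSum (edgeDefect n Up) (insert i (pathVerts n Up K))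
          + pathSum (edgeDefect n Up) (insert j (pathVerts n Up K))) ∧
      (¬ (i ∈ Up ↔ j ∈ Up) →
        pathSum (edgeDefect n Up) (insert i (pathVerts n Up K))
          + pathSum (edgeDefect n Up) (insert j (pathVerts n Up K))
        ≤ pathSum (edgeDefect n Up) (insert i (insert j (pathVerts n Up K)))
          + pathSum (edgeDefect n Up) (pathVerts n Up K)) := by
    intro K hiK hjK
    rcases pathSum_second_difference (edgeDefect n Up) (h0 K) (h1 K) (show 0 < i by omega) hij
      (show j < n + 1 by omega) hiK hjK with h | ⟨x, -, y, hy, hxi, hjy, h⟩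
    · exact ⟨fun _ => h.le, fun _ => h.ge⟩
    · rw [edgeDefect_second_difference] at h
      have := hP hxi hjy (le_of_mem_pathVerts hUp hy)
      exact ⟨fun hT => by linarith [this.1 hT], fun hT => by linarith [this.2 hT]⟩
  have c1 := card_Do_sdiff_insert (Up := Up) hi hiJ
  have c2 := card_Do_sdiff_insert (Up := Up) hj hjJ
  have c3 := card_Do_sdiff_insert (Up := Up) hi hi0
  simp only [suppFun, c1, c2, c3]
  rw [← sub_nonneg]
  ring_nf
  -- Among the four sets, the one with the fewest path vertices contains, of `i` and `j`, exactly
  -- those that are down; `hsd` is applied there.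
  by_cases hiU : i ∈ Up <;> by_cases hjU : j ∈ Up
  · have := (hsd J (by simp [hmem i hi, hiU, hiJ]) (by simp [hmem j hj, hjU, hjJ])).1
      (iff_of_true hiU hjU)
    rw [pathVerts_insert_of_mem hiU, pathVerts_insert_of_mem hiU, pathVerts_insert_of_mem hjU]
    linarith
  · have := (hsd (insert j J) (by simp [hmem i hi, hiU, hi0]) (by simp [hmem j hj, hjU])).2
      (by simp [hiU, hjU])
    rw [pathVerts_insert_of_mem hiU, pathVerts_insert_of_mem hiU,
      pathVerts_insert_of_notMem hj hjU hjJ]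
    linarith
  · have := (hsd (insert i J) (by simp [hmem i hi, hiU]) (by simp [hmem j hj, hjU, hj0])).2
      (by simp [hiU, hjU])
    rw [pathVerts_insert_of_mem hjU J, pathVerts_insert_of_notMem hi hiU hiJ,
      Finset.insert_comm i j J, pathVerts_insert_of_mem hjU (insert i J), Finset.insert_comm j i]
    linarith
  · have := (hsd (insert i (insert j J)) (by simp [hmem i hi, hiU]) (by simp [hmem j hj, hjU])).1
      (iff_of_false hiU hjU)
    have e1 := pathVerts_insert_of_notMem hi hiU hi0
    have e2 := pathVerts_insert_of_notMem hj hjU hj0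
    have e3 := pathVerts_insert_of_notMem hj hjU hjJ
    rw [Finset.insert_comm j i J] at e2
    rw [e3, e2, e1, Finset.insert_comm j i]
    linarith

theorem suppFun_supermodular (hUp : Up ⊆ Finset.Ioo 1 n) {J : Finset ℕ} {i j : ℕ}
    (hi : i ∈ Finset.Icc 1 n) (hj : j ∈ Finset.Icc 1 n) (hij : i ≠ j) (hiJ : i ∉ J) (hjJ : j ∉ J) :
    suppFun n Up (insert i J) - suppFun n Up J
      ≤ suppFun n Up (insert i (insert j J)) - suppFun n Up (insert j J) := by
  rcases hij.lt_or_gt with h | h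
  · linarith [suppFun_supermodular_of_lt hUp hi hj h hiJ hjJ]
  · have := suppFun_supermodular_of_lt hUp hj hi h hjJ hiJ
    rw [Finset.insert_comm] at this
    linarith

theorem suppFun_marginal_mono (hUp : Up ⊆ Finset.Ioo 1 n) (A B : Finset ℕ) (hAB : A ⊆ B)
    (hB : B ⊆ Finset.Icc 1 n) (i : ℕ) (hi : i ∈ Finset.Icc 1 n) (hiB : i ∉ B) :
    suppFun n Up (insert i A) - suppFun n Up A ≤ suppFun n Up (insert i B) - suppFun n Up B := by
  induction B using Finset.strongInduction with
  | H B ih =>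
    rcases hAB.eq_or_ssubset with rfl | hss
    · exact le_rfl
    obtain ⟨j, hjB, hjA⟩ := Finset.exists_of_ssubset hss
    have h1 := ih (B.erase j) (Finset.erase_ssubset hjB)
      (fun k hk => Finset.mem_erase.2 ⟨by rintro rfl; exact hjA hk, hAB hk⟩)
      ((Finset.erase_subset j B).trans hB) (fun h => hiB (Finset.mem_of_mem_erase h))
    have h2 := suppFun_supermodular hUp (J := B.erase j) hi (hB hjB)
      (by rintro rfl; exact hiB hjB) (fun h => hiB (Finset.mem_of_mem_erase h))
      (Finset.notMem_erase j B)
    rw [Finset.insert_erase hjB] at h2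
    exact h1.trans h2

/-- A greedy point satisfies the bound for every `J`, in particular for every `R`, where `suppFun_R`
identifies it with the defining inequality; so it lies in the polytope. -/
theorem hasSupport_associahedron (hn : 1 ≤ n) (hUp : Up ⊆ Finset.Ioo 1 n) :
    HasSupport n (associahedron n Up) (suppFun n Up) where
  total x hx := by
    rw [suppFun_Icc hn hUp]
    exact hx.1
  le x hx J hJ := suppFun_le_coordSum hUp hx hJ
  tight ρ hρ := by
    obtain ⟨p, hp, hle⟩ := exists_greedy (suppFun_empty hn hUp) (suppFun_marginal_mono hUp) ρ hρ
    refine ⟨p, ⟨?_, fun d e hde => ?_⟩, hp⟩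
    · have := hp 0
      rw [show superlevel n ρ 0 = Finset.Icc 1 n by simp [superlevel], suppFun_Icc hn hUp] at this
      exact this
    · have := hle _ (R_subset hUp hde.1 hde.2.1)
      rwa [suppFun_R hn hUp hde.1 hde.2.1] at this

theorem convex_associahedron : Convex ℝ (associahedron n Up) := by
  intro x hx y hy a b ha hb hab
  refine ⟨?_, fun d e hde => ?_⟩
  · rw [coordSum_add, coordSum_smul, coordSum_smul, hx.1, hy.1, ← add_mul, hab, one_mul]
  · rw [coordSum_add, coordSum_smul, coordSum_smul]
    have h1 := mul_le_mul_of_nonneg_left (hx.2 d e hde) ha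
    have h2 := mul_le_mul_of_nonneg_left (hy.2 d e hde) hb
    refine le_trans (le_of_eq ?_) (add_le_add h1 h2)
    rw [← add_mul, hab, one_mul]

theorem isClosed_associahedron : IsClosed (associahedron n Up) := by
  refine (isClosed_eq (continuous_coordSum n _) continuous_const).inter ?_
  have h : ∀ S : ℕ → ℕ → Set (Finset.Icc 1 n → ℝ),
      (∀ d e, IsProperDiagonal n Up d e → IsClosed (S d e)) →
      IsClosed {x | ∀ d e : ℕ, IsProperDiagonal n Up d e → x ∈ S d e} := by
    intro S hS
    have : {x | ∀ d e : ℕ, IsProperDiagonal n Up d e → x ∈ S d e}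
        = ⋂ d, ⋂ e, ⋂ _ : IsProperDiagonal n Up d e, S d e := by
      ext x
      simp
    rw [this]
    exact isClosed_iInter fun d => isClosed_iInter fun e => isClosed_iInter fun h => hS d e h
  exact h (fun d e => {x | _ ≤ coordSum n x (R n Up d e)}) fun d e _ =>
    isClosed_le continuous_const (continuous_coordSum n _)

end Support

/-! ### Möbius inversion, edge by edge. -/

/-- The elements that a subset of `[x, y]` has to contain exactly for `x` and `y` to be consecutive
on its path. -/
def edgeCore (n : ℕ) (Up : Finset ℕ) (x y : ℕ) : Finset ℕ :=
  (Finset.Icc 1 n).filter fun i => if i ∈ Up then i = x ∨ i = y else x < i ∧ i < y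

/-- The pairs `x < y` with `edgeCore n Up x y ⊆ I ⊆ [x, y]`. -/
def coreEdges (n : ℕ) (Up I : Finset ℕ) : Finset (ℕ × ℕ) :=
  (Finset.range (n + 2) ×ˢ Finset.range (n + 2)).filter fun e =>
    e.1 < e.2 ∧ edgeCore n Up e.1 e.2 ⊆ I ∧ I ⊆ Finset.Icc e.1 e.2

/-- The signed sum of the defects of the edges that contribute to the Minkowski coefficient. -/
noncomputable def coreSum (n : ℕ) (Up I : Finset ℕ) : ℝ :=
  ∑ e ∈ coreEdges n Up I, (-1) ^ (I \ edgeCore n Up e.1 e.2).card * edgeDefect n Up e.1 e.2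

/-- The Minkowski coefficient of the associahedron at `I`. -/
noncomputable def minkCoeff (n : ℕ) (Up I : Finset ℕ) : ℝ :=
  -(if ∃ d ∈ Do n Up, I = {d} then tri n else 0) - coreSum n Up I

theorem sum_powerset_superset_neg_one_pow (M K : Finset ℕ) :
    ∑ I ∈ K.powerset with M ⊆ I, (-1 : ℝ) ^ (I \ M).card = if K = M then 1 else 0 := by
  by_cases hMK : M ⊆ K
  · have h : ∑ I ∈ K.powerset with M ⊆ I, (-1 : ℝ) ^ (I \ M).card
        = ∑ S ∈ (K \ M).powerset, (-1 : ℝ) ^ S.card := by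
      refine Finset.sum_bij' (fun I _ => I \ M) (fun S _ => S ∪ M) ?_ ?_ ?_ ?_ ?_
      · intro I hI
        rw [Finset.mem_filter, Finset.mem_powerset] at hI
        exact Finset.mem_powerset.2 (Finset.sdiff_subset_sdiff hI.1 subset_rfl)
      · intro S hS
        rw [Finset.mem_powerset] at hS
        rw [Finset.mem_filter, Finset.mem_powerset]
        exact ⟨Finset.union_subset (hS.trans Finset.sdiff_subset) hMK, Finset.subset_union_right⟩
      · intro I hI
        rw [Finset.mem_filter] at hI
        exact Finset.sdiff_union_of_subset hI.2
      · intro S hS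
        rw [Finset.mem_powerset] at hS
        exact Finset.union_sdiff_cancel_right
          (Finset.disjoint_of_subset_left hS Finset.sdiff_disjoint)
      · intro I _
        rfl
    have h2 : ∑ S ∈ (K \ M).powerset, (-1 : ℝ) ^ S.card = if K \ M = ∅ then 1 else 0 := by
      have := Finset.sum_powerset_neg_one_pow_card (x := K \ M)
      have h3 : ((∑ S ∈ (K \ M).powerset, (-1 : ℤ) ^ S.card : ℤ) : ℝ)
          = ((if K \ M = ∅ then 1 else 0 : ℤ) : ℝ) := by rw [this]
      push_cast at h3
      exact h3
    rw [h, h2]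
    refine if_congr ?_ rfl rfl
    rw [Finset.sdiff_eq_empty_iff_subset]
    exact ⟨fun h' => h'.antisymm hMK, fun h' => h'.subset⟩
  · rw [Finset.filter_false_of_mem, Finset.sum_empty, if_neg]
    · rintro rfl
      exact hMK subset_rfl
    · intro I hI h
      exact hMK (h.trans (Finset.mem_powerset.1 hI))

section Mobius

variable {n : ℕ} {Up : Finset ℕ}

theorem mem_edgeCore {x y i : ℕ} : i ∈ edgeCore n Up x y ↔
    (1 ≤ i ∧ i ≤ n) ∧ if i ∈ Up then i = x ∨ i = y else x < i ∧ i < y := by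
  simp [edgeCore]

/-- Being an edge of the path depends on `J` only inside `[x, y]` and prescribes `J` there, so its
indicator has an explicit Möbius inverse. -/
theorem mem_consecutive_pathVerts (hUp : Up ⊆ Finset.Ioo 1 n) {J : Finset ℕ}
    (hJ : J ⊆ Finset.Icc 1 n) {x y : ℕ} : (x, y) ∈ consecutive (pathVerts n Up J) ↔
      (x < y ∧ y ≤ n + 1) ∧ J ∩ Finset.Icc x y = edgeCore n Up x y := by
  have hUp' : ∀ u ∈ Up, 1 < u ∧ u < n := fun u hu => Finset.mem_Ioo.1 (hUp hu)
  have hJ' : ∀ i ∈ J, 1 ≤ i ∧ i ≤ n := fun i hi => Finset.mem_Icc.1 (hJ hi)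
  have hmem : ∀ k, 1 ≤ k → k ≤ n → (k ∈ pathVerts n Up J ↔ (k ∈ J ↔ k ∈ Up)) := by
    intro k h1 h2
    rw [mem_pathVerts]
    by_cases hk : k ∈ Up <;> by_cases hk' : k ∈ J <;> simp [hk, hk'] <;> omega
  have hend : ∀ k, k = 0 ∨ k = n + 1 → k ∈ pathVerts n Up J := fun k hk =>
    mem_pathVerts.2 (Or.inl hk)
  rw [mem_consecutive]
  constructor
  · rintro ⟨hx, hy, hxy, hz⟩
    refine ⟨⟨hxy, le_of_mem_pathVerts hUp hy⟩, ?_⟩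
    ext i
    rw [Finset.mem_inter, Finset.mem_Icc, mem_edgeCore]
    constructor
    · rintro ⟨hi, hxi, hiy⟩
      have hin := hJ' i hi
      refine ⟨hin, ?_⟩
      have h1 := hz i
      rw [hmem i hin.1 hin.2] at h1
      split_ifs with hiU
      · have := h1 (iff_of_true hi hiU)
        omega
      · have hne : i ∉ pathVerts n Up J := by
          rw [hmem i hin.1 hin.2]
          simp [hi, hiU]
        have hix : i ≠ x := by rintro rfl; exact hne hx
        have hiy : i ≠ y := by rintro rfl; exact hne hy
        omega
    · rintro ⟨hin, hi⟩
      split_ifs at hi with hiU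
      · rcases hi with rfl | rfl
        · exact ⟨((hmem i hin.1 hin.2).1 hx).2 hiU, le_rfl, hxy.le⟩
        · exact ⟨((hmem i hin.1 hin.2).1 hy).2 hiU, hxy.le, le_rfl⟩
      · refine ⟨?_, hi.1.le, hi.2.le⟩
        by_contra hiJ
        exact hz i ((hmem i hin.1 hin.2).2 (iff_of_false hiJ hiU)) hi
  · rintro ⟨⟨hxy, hy⟩, heq⟩
    have hiff : ∀ i, 1 ≤ i → i ≤ n → x ≤ i → i ≤ y →
        (i ∈ J ↔ if i ∈ Up then i = x ∨ i = y else x < i ∧ i < y) := by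
      intro i h1 h2 h3 h4
      have := Finset.ext_iff.1 heq i
      rw [Finset.mem_inter, Finset.mem_Icc, mem_edgeCore] at this
      simpa [h1, h2, h3, h4] using this
    refine ⟨?_, ?_, hxy, fun z hz hxz => ?_⟩
    · by_cases h : x = 0
      · exact hend x (Or.inl h)
      · rw [hmem x (by omega) (by omega), hiff x (by omega) (by omega) le_rfl hxy.le]
        by_cases hxU : x ∈ Up <;> simp [hxU]
    · by_cases h : y = n + 1
      · exact hend y (Or.inr h)
      · rw [hmem y (by omega) (by omega), hiff y (by omega) (by omega) hxy.le le_rfl]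
        by_cases hyU : y ∈ Up <;> simp [hyU]
    · rw [hmem z (by omega) (by omega), hiff z (by omega) (by omega) hxz.1.le hxz.2.le] at hz
      by_cases hzU : z ∈ Up
      · simp only [hzU, if_true, iff_true] at hz
        omega
      · simp only [hzU, if_false, iff_false] at hz
        omega

theorem sum_coreSum (hUp : Up ⊆ Finset.Ioo 1 n) {J : Finset ℕ} (hJ : J ⊆ Finset.Icc 1 n) :
    ∑ I ∈ J.powerset, coreSum n Up I = pathSum (edgeDefect n Up) (pathVerts n Up J) := by
  simp only [coreSum, coreEdges, Finset.sum_filter]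
  rw [Finset.sum_comm]
  have hcons : consecutive (pathVerts n Up J)
      = (Finset.range (n + 2) ×ˢ Finset.range (n + 2)).filter fun e =>
        e.1 < e.2 ∧ J ∩ Finset.Icc e.1 e.2 = edgeCore n Up e.1 e.2 := by
    ext ⟨x, y⟩
    rw [mem_consecutive_pathVerts hUp hJ, Finset.mem_filter, Finset.mem_product, Finset.mem_range,
      Finset.mem_range]
    dsimp only
    constructor
    · rintro ⟨h1, h2⟩
      exact ⟨by omega, h1.1, h2⟩
    · rintro ⟨h1, h2, h3⟩
      exact ⟨by omega, h3⟩
  rw [pathSum, hcons, Finset.sum_filter]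
  refine Finset.sum_congr rfl fun e _ => ?_
  by_cases he : e.1 < e.2
  · have h := sum_powerset_superset_neg_one_pow (edgeCore n Up e.1 e.2) (J ∩ Finset.Icc e.1 e.2)
    have h2 : (J ∩ Finset.Icc e.1 e.2).powerset.filter (fun I => edgeCore n Up e.1 e.2 ⊆ I)
        = J.powerset.filter fun I =>
          e.1 < e.2 ∧ edgeCore n Up e.1 e.2 ⊆ I ∧ I ⊆ Finset.Icc e.1 e.2 := by
      ext I
      simp only [Finset.mem_filter, Finset.mem_powerset, Finset.subset_inter_iff, he, true_and]
      tauto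
    rw [← Finset.sum_filter, ← Finset.sum_mul, ← h2, h]
    simp only [he, true_and, ite_mul, one_mul, zero_mul]
  · simp [he]

theorem sum_minkCoeff (hn : 1 ≤ n) (hUp : Up ⊆ Finset.Ioo 1 n) {J : Finset ℕ}
    (hJ : J ⊆ Finset.Icc 1 n) :
    ∑ I ∈ J.powerset with I.Nonempty, minkCoeff n Up I = suppFun n Up J := by
  -- The empty set carries the constant term, which disappears when only non-empty `I` are summed.
  have h0 : coreSum n Up ∅ = ((Do n Up).card + 1) * tri n := by
    have h := sum_coreSum hUp (Finset.empty_subset (Finset.Icc 1 n))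
    have h' := suppFun_empty hn hUp
    rw [suppFun, Finset.sdiff_empty] at h'
    rw [Finset.powerset_empty, Finset.sum_singleton] at h
    linarith
  have hfil : J.powerset.filter (fun I => I.Nonempty) = J.powerset.erase ∅ := by
    ext I
    simp [Finset.nonempty_iff_ne_empty, and_comm]
  have h1 : ∑ I ∈ J.powerset with I.Nonempty, coreSum n Up I
      = pathSum (edgeDefect n Up) (pathVerts n Up J) - ((Do n Up).card + 1) * tri n := by
    rw [hfil, ← sum_coreSum hUp hJ, ← h0,
      ← Finset.sum_erase_add _ _ (Finset.empty_mem_powerset J)]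
    ring
  -- The term in `|Do \ J|` depends on `J` through `|Do ∩ J|`, whose Möbius inverse is supported on
  -- down singletons.
  have h2 : ∑ I ∈ J.powerset with I.Nonempty, (if ∃ d ∈ Do n Up, I = {d} then tri n else 0)
      = (Do n Up ∩ J).card * tri n := by
    rw [← Finset.sum_filter, Finset.sum_const, nsmul_eq_mul,
      ← Finset.card_image_of_injective (Do n Up ∩ J) (Finset.singleton_injective)]
    congr 3
    ext I
    simp only [Finset.mem_filter, Finset.mem_powerset, Finset.mem_image, Finset.mem_inter]
    constructor
    · rintro ⟨⟨hIJ, -⟩, d, hd, rfl⟩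
      exact ⟨d, ⟨hd, hIJ (Finset.mem_singleton_self d)⟩, rfl⟩
    · rintro ⟨d, ⟨hd, hdJ⟩, rfl⟩
      exact ⟨⟨Finset.singleton_subset_iff.2 hdJ, Finset.singleton_nonempty d⟩, d, hd, rfl⟩
  have h3 : ((Do n Up ∩ J).card : ℝ) + (Do n Up \ J).card = (Do n Up).card := by
    exact_mod_cast Finset.card_inter_add_card_sdiff (Do n Up) J
  simp only [minkCoeff, Finset.sum_sub_distrib, Finset.sum_neg_distrib]
  rw [h1, h2, suppFun, ← h3]
  ring

theorem eq_of_sum_powerset_eq {y z : Finset ℕ → ℝ} {K : Finset ℕ}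
    (h : ∀ J ⊆ K, ∑ I ∈ J.powerset with I.Nonempty, y I = ∑ I ∈ J.powerset with I.Nonempty, z I)
    {I : Finset ℕ} (hI : I ⊆ K) (hne : I.Nonempty) : y I = z I := by
  induction I using Finset.strongInduction with
  | H I ih =>
    have hmem : I ∈ I.powerset.filter fun S => S.Nonempty :=
      Finset.mem_filter.2 ⟨Finset.mem_powerset_self I, hne⟩
    have h1 := h I hI
    rw [← Finset.sum_erase_add _ _ hmem, ← Finset.sum_erase_add _ _ hmem] at h1
    rw [Finset.sum_congr rfl (g := z)] at h1
    · linarith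
    · intro S hS
      rw [Finset.mem_erase, Finset.mem_filter, Finset.mem_powerset] at hS
      exact ih S (hS.2.1.ssubset_of_ne hS.1) (hS.2.1.trans hI) hS.2.2

end Mobius

/-! ### Nested sets and the product formula. -/

section Nested

variable {n : ℕ} {Up I : Finset ℕ}

theorem neg_one_pow_card_toggle {M M' : Finset ℕ} {g : ℕ} (hg : g ∈ I)
    (h : ∀ i ∈ I, i ≠ g → (i ∈ M ↔ i ∈ M')) (hM : g ∈ M ↔ g ∉ M') :
    (-1 : ℝ) ^ (I \ M).card = -(-1) ^ (I \ M').card := by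
  have key : ∀ {S S' : Finset ℕ}, (∀ i ∈ I, i ≠ g → (i ∈ S ↔ i ∈ S')) → g ∈ S → g ∉ S' →
      (-1 : ℝ) ^ (I \ S').card = -(-1) ^ (I \ S).card := by
    intro S S' hS hgS hgS'
    have : I \ S' = insert g (I \ S) := by
      ext i
      rw [Finset.mem_insert, Finset.mem_sdiff, Finset.mem_sdiff]
      by_cases hi : i = g
      · subst hi
        simp [hg, hgS']
      · simp only [hi, false_or]
        exact and_congr_right fun hiI => not_congr (hS i hiI hi).symm
    rw [this, Finset.card_insert_of_notMem (by simp [hgS]), pow_succ]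
    ring
  by_cases hgM : g ∈ M
  · rw [key h hgM (hM.1 hgM), neg_neg]
  · refine key (fun i hi hne => (h i hi hne).symm) ?_ hgM
    by_contra hg'
    exact hgM (hM.2 hg')

/-- Moving the left end from `a` to the minimum `g` changes the core, within `I`, only at `g`: an up
`g` enters and a down `g` leaves. -/
theorem sign_left {a g y : ℕ} (hI : I ⊆ Finset.Icc 1 n) (hg : g ∈ I) (hmin : ∀ i ∈ I, g ≤ i)
    (hag : a < g) (hgy : g < y) : (-1 : ℝ) ^ (I \ edgeCore n Up g y).card
      = -(-1) ^ (I \ edgeCore n Up a y).card := by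
  refine neg_one_pow_card_toggle hg (fun i hi hne => ?_) ?_
  · have := hmin i hi
    rw [mem_edgeCore, mem_edgeCore]
    split_ifs <;> omega
  · have := Finset.mem_Icc.1 (hI hg)
    rw [mem_edgeCore, mem_edgeCore]
    split_ifs <;> omega

theorem sign_right {x g b : ℕ} (hI : I ⊆ Finset.Icc 1 n) (hg : g ∈ I) (hmax : ∀ i ∈ I, i ≤ g)
    (hxg : x < g) (hgb : g < b) : (-1 : ℝ) ^ (I \ edgeCore n Up x g).card
      = -(-1) ^ (I \ edgeCore n Up x b).card := by
  refine neg_one_pow_card_toggle hg (fun i hi hne => ?_) ?_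
  · have := hmax i hi
    rw [mem_edgeCore, mem_edgeCore]
    split_ifs <;> omega
  · have := Finset.mem_Icc.1 (hI hg)
    rw [mem_edgeCore, mem_edgeCore]
    split_ifs <;> omega

theorem mem_DoBar {i : ℕ} :
    i ∈ DoBar n Up ↔ ((1 ≤ i ∧ i ≤ n) ∧ i ∉ Up) ∨ i = 0 ∨ i = n + 1 := by
  simp only [DoBar, Finset.mem_union, Finset.mem_insert, Finset.mem_singleton, mem_Do]

theorem mem_downInt {a b i : ℕ} :
    i ∈ downInt n Up a b ↔ ((1 ≤ i ∧ i ≤ n) ∧ i ∉ Up) ∧ a < i ∧ i < b := by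
  simp [downInt, mem_Do]

theorem notMem_Up_of_mem_DoBar (hUp : Up ⊆ Finset.Ioo 1 n) {i : ℕ} (hi : i ∈ DoBar n Up) :
    i ∉ Up := by
  intro h
  have := Finset.mem_Ioo.1 (hUp h)
  rw [mem_DoBar] at hi
  rcases hi with hi | hi
  · exact hi.2 h
  · omega

theorem le_of_mem_DoBar {i : ℕ} (hi : i ∈ DoBar n Up) : i ≤ n + 1 := by
  rw [mem_DoBar] at hi
  omega

/-- `(a, b)` are the end points of a down interval with the down elements of `I` between them, and
`a`, `b` are outside of `I`. -/
structure IsGap (n : ℕ) (Up I : Finset ℕ) (a b : ℕ) : Prop where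
  left : a ∈ DoBar n Up
  right : b ∈ DoBar n Up
  lt : a < b
  left_notMem : a ∉ I
  right_notMem : b ∉ I
  subset : downInt n Up a b ⊆ I

theorem IsGap.eq_of_overlap {a b a' b' : ℕ} (h : IsGap n Up I a b) (h' : IsGap n Up I a' b')
    (h1 : a < b') (h2 : a' < b) : a = a' ∧ b = b' := by
  have key : ∀ {a b a' b' : ℕ}, IsGap n Up I a b → IsGap n Up I a' b' → a < b' → a' < b →
      ¬ a < a' ∧ ¬ b' < b := by
    intro a b a' b' h h' h1 h2
    have hb := le_of_mem_DoBar h.right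
    constructor
    · intro hlt
      have := mem_DoBar.1 h'.left
      refine h'.left_notMem (h.subset (mem_downInt.2 ⟨?_, hlt, h2⟩))
      rcases this with this | this
      · exact this
      · omega
    · intro hlt
      have := mem_DoBar.1 h'.right
      refine h'.right_notMem (h.subset (mem_downInt.2 ⟨?_, h1, hlt⟩))
      rcases this with this | this
      · exact this
      · omega
  have k1 := key h h' h1 h2
  have k2 := key h' h h2 h1
  omega

theorem exists_gap (hI : I ⊆ Finset.Icc 1 n) {i : ℕ} (hi : i ∈ I) :
    ∃ a b, IsGap n Up I a b ∧ a < i ∧ i < b := by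
  have hin := Finset.mem_Icc.1 (hI hi)
  have hI' : ∀ k ∈ I, 1 ≤ k ∧ k ≤ n := fun k hk => Finset.mem_Icc.1 (hI hk)
  obtain ⟨a, ha, hamax⟩ := Finset.exists_max_image
    ((DoBar n Up).filter fun d => d < i ∧ d ∉ I) id
    ⟨0, Finset.mem_filter.2 ⟨mem_DoBar.2 (Or.inr (Or.inl rfl)), by omega, fun h => by
      have := hI' 0 h
      omega⟩⟩
  obtain ⟨b, hb, hbmin⟩ := Finset.exists_min_image
    ((DoBar n Up).filter fun d => i < d ∧ d ∉ I) id
    ⟨n + 1, Finset.mem_filter.2 ⟨mem_DoBar.2 (Or.inr (Or.inr rfl)), by omega, fun h => by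
      have := hI' (n + 1) h
      omega⟩⟩
  rw [Finset.mem_filter] at ha hb
  refine ⟨a, b, ⟨ha.1, hb.1, by omega, ha.2.2, hb.2.2, fun d hd => ?_⟩, ha.2.1, hb.2.1⟩
  rw [mem_downInt] at hd
  by_contra hdI
  have hdD : d ∈ DoBar n Up := mem_DoBar.2 (Or.inl hd.1)
  rcases lt_trichotomy d i with h | rfl | h
  · have := hamax d (Finset.mem_filter.2 ⟨hdD, h, hdI⟩)
    simp only [id] at this
    omega
  · exact hdI hi
  · have := hbmin d (Finset.mem_filter.2 ⟨hdD, h, hdI⟩)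
    simp only [id] at this
    omega

theorem mem_maxDownIntervals {a b : ℕ} : (a, b) ∈ maxDownIntervals n Up I ↔
    (a ∈ DoBar n Up ∧ b ∈ DoBar n Up) ∧
      (downInt n Up a b).Nonempty ∧ downInt n Up a b ⊆ I ∧ a ∉ I ∧ b ∉ I := by
  simp [maxDownIntervals]

theorem isGap_of_mem_maxDownIntervals {q : ℕ × ℕ} (h : q ∈ maxDownIntervals n Up I) :
    IsGap n Up I q.1 q.2 := by
  obtain ⟨h1, ⟨d, hd⟩, h2, h3, h4⟩ := mem_maxDownIntervals.1 (show (q.1, q.2) ∈ _ from h)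
  exact ⟨h1.1, h1.2, (mem_downInt.1 hd).2.1.trans (mem_downInt.1 hd).2.2, h3, h4, h2⟩

theorem isGap_of_mem_emptyDownIntervals (hI : I ⊆ Finset.Icc 1 n) {q : ℕ × ℕ}
    (h : q ∈ emptyDownIntervals n Up I) : IsGap n Up I q.1 q.2 := by
  rw [emptyDownIntervals, Finset.mem_filter, Finset.mem_product, mem_Do, mem_Do] at h
  obtain ⟨⟨h1, h2⟩, hlt, hempty, hsep⟩ := h
  -- A down label in `I` is strictly inside some non-empty maximal interval, so the separation
  -- condition keeps the end points of an empty interval out of `I`.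
  have key : ∀ d, (1 ≤ d ∧ d ≤ n) ∧ d ∉ Up → d ∈ I → ∃ p ∈ maxDownIntervals n Up I,
      p.1 < d ∧ d < p.2 := by
    intro d hd hdI
    obtain ⟨a, b, hgap, ha, hb⟩ := exists_gap (Up := Up) hI hdI
    exact ⟨(a, b), mem_maxDownIntervals.2 ⟨⟨hgap.left, hgap.right⟩,
      ⟨d, mem_downInt.2 ⟨hd, ha, hb⟩⟩, hgap.subset, hgap.left_notMem, hgap.right_notMem⟩, ha, hb⟩
  refine ⟨mem_DoBar.2 (Or.inl h1), mem_DoBar.2 (Or.inl h2), hlt, fun hq => ?_, fun hq => ?_, ?_⟩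
  · obtain ⟨p, hp, hp1, hp2⟩ := key _ h1 hq
    have := hsep p hp
    omega
  · obtain ⟨p, hp, hp1, hp2⟩ := key _ h2 hq
    have := hsep p hp
    omega
  · rw [hempty]
    exact Finset.empty_subset I

theorem downIntervals_spec (hI : I ⊆ Finset.Icc 1 n) {q : ℕ × ℕ}
    (h : q ∈ downIntervals n Up I) :
    IsGap n Up I q.1 q.2 ∧ ∃ i ∈ I, q.1 < i ∧ i < q.2 := by
  rw [downIntervals, Finset.mem_union, Finset.mem_filter] at h
  rcases h with h | ⟨h, r, hr, hr1, hr2⟩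
  · have hgap := isGap_of_mem_maxDownIntervals h
    obtain ⟨-, ⟨d, hd⟩, h2, -⟩ := mem_maxDownIntervals.1 (show (q.1, q.2) ∈ _ from h)
    exact ⟨hgap, d, h2 hd, (mem_downInt.1 hd).2⟩
  · refine ⟨isGap_of_mem_emptyDownIntervals hI h, ?_⟩
    rw [upIntervals, Finset.mem_filter, Finset.mem_product] at hr
    obtain ⟨hrU, p, -, hp, -⟩ := hr
    refine ⟨r.1, hp.2.1 ?_, hr1, hp.1.trans_lt hr2⟩
    exact Finset.mem_filter.2 ⟨hrU.1, le_rfl, hp.1⟩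

/-- Each element of `I` lies in one of the intervals of integers spanned by the down intervals of
the decomposition. -/
theorem exists_mem_downIntervals (hUp : Up ⊆ Finset.Ioo 1 n) (hI : I ⊆ Finset.Icc 1 n) {i : ℕ}
    (hi : i ∈ I) : ∃ q ∈ downIntervals n Up I, q.1 < i ∧ i < q.2 := by
  obtain ⟨a, b, hgap, hai, hib⟩ := exists_gap (Up := Up) hI hi
  refine ⟨(a, b), ?_, hai, hib⟩
  rw [downIntervals, Finset.mem_union, Finset.mem_filter]
  rcases (downInt n Up a b).eq_empty_or_nonempty with he | hne
  · right
    have hin := Finset.mem_Icc.1 (hI hi)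
    have hiU : i ∈ Up := by
      by_contra hiU
      have : i ∈ downInt n Up a b := mem_downInt.2 ⟨⟨hin, hiU⟩, hai, hib⟩
      rw [he] at this
      simp at this
    have hi1 := Finset.mem_Ioo.1 (hUp hiU)
    have hDo : ∀ d, (1 ≤ d ∧ d ≤ n) ∧ d ∉ Up → ¬ (a < d ∧ d < b) := by
      intro d hd h
      have : d ∈ downInt n Up a b := mem_downInt.2 ⟨hd, h⟩
      rw [he] at this
      simp at this
    have ha : a ∈ Do n Up := by
      rw [mem_Do]
      rcases mem_DoBar.1 hgap.left with h | h
      · exact h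
      -- The left end cannot be `0`, because the down label `1` would lie in the empty interval; `n`
      -- plays the same role on the right.
      · have := hDo 1 ⟨by omega, fun h => by simpa using hUp h⟩
        omega
    have hb : b ∈ Do n Up := by
      rw [mem_Do]
      rcases mem_DoBar.1 hgap.right with h | h
      · exact h
      · have := hDo n ⟨by omega, fun h => by simpa using hUp h⟩
        omega
    have hmem : (a, b) ∈ emptyDownIntervals n Up I := by
      rw [emptyDownIntervals, Finset.mem_filter, Finset.mem_product]
      refine ⟨⟨ha, hb⟩, hgap.lt, he, fun q hq => ?_⟩
      by_contra hcon
      rw [not_or, not_le, not_le] at hcon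
      have heq := (isGap_of_mem_maxDownIntervals hq).eq_of_overlap hgap hcon.1 hcon.2
      obtain ⟨-, hne, -⟩ := mem_maxDownIntervals.1 (show (q.1, q.2) ∈ _ from hq)
      rw [heq.1, heq.2, he] at hne
      simp at hne
    refine ⟨hmem, ?_⟩
    -- A longest up interval is inclusion-maximal; the one-element interval at `i` shows that one
    -- exists.
    obtain ⟨q, hq, hqmax⟩ := Finset.exists_max_image
      ((Up ×ˢ Up).filter fun q => IsUpIntervalIn Up I (a, b) q) (fun q => q.2 - q.1)
      ⟨(i, i), by
        refine Finset.mem_filter.2 ⟨Finset.mem_product.2 ⟨hiU, hiU⟩, le_rfl, fun k hk => ?_, hai,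
          hib⟩
        have hk' := (Finset.mem_filter.1 hk).2
        rwa [show k = i from le_antisymm hk'.2 hk'.1]⟩
    rw [Finset.mem_filter] at hq
    refine ⟨q, ?_, hq.2.2.2⟩
    rw [upIntervals, Finset.mem_filter]
    refine ⟨hq.1, (a, b), Finset.mem_union_right _ hmem, hq.2, fun q' hq' hin' h1 h2 => ?_⟩
    have : q'.2 - q'.1 ≤ q.2 - q.1 := hqmax q' (Finset.mem_filter.2 ⟨hq', hin'⟩)
    have h3 := hq.2.1
    refine Prod.ext ?_ ?_ <;> omega
  · left
    exact mem_maxDownIntervals.2 ⟨⟨hgap.left, hgap.right⟩, hne, hgap.subset, hgap.left_notMem,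
      hgap.right_notMem⟩

theorem mem_coreEdges {x y : ℕ} : (x, y) ∈ coreEdges n Up I ↔
    (x < y ∧ y ≤ n + 1) ∧ edgeCore n Up x y ⊆ I ∧ I ⊆ Finset.Icc x y := by
  rw [coreEdges, Finset.mem_filter, Finset.mem_product, Finset.mem_range, Finset.mem_range]
  dsimp only
  constructor
  · rintro ⟨h1, h2, h3⟩
    exact ⟨by omega, h3⟩
  · rintro ⟨h1, h2⟩
    exact ⟨by omega, h1.1, h2⟩

/-- Between two down intervals sits a down label outside `I` with elements of `I` on both sides. Any
edge spanning `I` has that label in its core, so no edge contributes. -/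
theorem minkCoeff_eq_zero (hI : I ⊆ Finset.Icc 1 n) (h : 2 ≤ (downIntervals n Up I).card) :
    minkCoeff n Up I = 0 := by
  obtain ⟨p, hp, q, hq, hpq⟩ := Finset.one_lt_card.1 h
  obtain ⟨d, hd, hdI, i, hi, j, hj, hid, hdj⟩ : ∃ d, ((1 ≤ d ∧ d ≤ n) ∧ d ∉ Up) ∧ d ∉ I ∧
      ∃ i ∈ I, ∃ j ∈ I, i < d ∧ d < j := by
    have key : ∀ {p q : ℕ × ℕ}, p ∈ downIntervals n Up I → q ∈ downIntervals n Up I →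
        p.2 ≤ q.1 → ∃ d, ((1 ≤ d ∧ d ≤ n) ∧ d ∉ Up) ∧ d ∉ I ∧ ∃ i ∈ I, ∃ j ∈ I, i < d ∧ d < j := by
      intro p q hp hq hle
      obtain ⟨hp1, i, hi, hpi, hip⟩ := downIntervals_spec hI hp
      obtain ⟨hq1, j, hj, hqj, hjq⟩ := downIntervals_spec hI hq
      refine ⟨p.2, ?_, hp1.right_notMem, i, hi, j, hj, hip, by omega⟩
      have h3 := Finset.mem_Icc.1 (hI hj)
      rcases mem_DoBar.1 hp1.right with h | h
      · exact h
      · omega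
    by_cases h1 : p.2 ≤ q.1
    · exact key hp hq h1
    by_cases h2 : q.2 ≤ p.1
    · exact key hq hp h2
    have heq := (downIntervals_spec hI hp).1.eq_of_overlap (downIntervals_spec hI hq).1
      (by omega) (by omega)
    exact absurd (Prod.ext heq.1 heq.2) hpq
  have h1 : ¬ ∃ d ∈ Do n Up, I = {d} := by
    rintro ⟨k, -, rfl⟩
    rw [Finset.mem_singleton] at hi hj
    omega
  have h2 : coreEdges n Up I = ∅ := by
    rw [Finset.eq_empty_iff_forall_notMem]
    rintro ⟨x, y⟩ he
    obtain ⟨-, hcore, hIcc⟩ := mem_coreEdges.1 he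
    have hi' := Finset.mem_Icc.1 (hIcc hi)
    have hj' := Finset.mem_Icc.1 (hIcc hj)
    refine hdI (hcore (mem_edgeCore.2 ⟨hd.1, ?_⟩))
    rw [if_neg hd.2]
    omega
  rw [minkCoeff, if_neg h1, coreSum, h2]
  simp

/-- The edges contributing to the Minkowski coefficient of a nested set. -/
theorem coreEdges_eq {a b g G : ℕ} (hgap : IsGap n Up I a b)
    (hUp : Up ⊆ Finset.Ioo 1 n) (hI : I ⊆ Finset.Icc 1 n) (hg : g ∈ I) (hG : G ∈ I)
    (hmin : ∀ i ∈ I, g ≤ i) (hmax : ∀ i ∈ I, i ≤ G) (hag : a < g) (hGb : G < b) :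
    coreEdges n Up I = (({a, g} : Finset ℕ) ×ˢ ({b, G} : Finset ℕ)).filter fun e => e.1 < e.2 := by
  have hgG := hmin G hG
  have hb := le_of_mem_DoBar hgap.right
  have haU := notMem_Up_of_mem_DoBar hUp hgap.left
  have hbU := notMem_Up_of_mem_DoBar hUp hgap.right
  have hUp' : ∀ u ∈ Up, 1 < u ∧ u < n := fun u hu => Finset.mem_Ioo.1 (hUp hu)
  have hgn := Finset.mem_Icc.1 (hI hg)
  have hGn := Finset.mem_Icc.1 (hI hG)
  ext ⟨x, y⟩
  rw [mem_coreEdges, Finset.mem_filter, Finset.mem_product]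
  simp only [Finset.mem_insert, Finset.mem_singleton]
  constructor
  · rintro ⟨⟨hxy, hy⟩, hcore, hIcc⟩
    have hxg := (Finset.mem_Icc.1 (hIcc hg)).1
    have hGy := (Finset.mem_Icc.1 (hIcc hG)).2
    have hmem : ∀ i, 1 ≤ i → i ≤ n → (if i ∈ Up then i = x ∨ i = y else x < i ∧ i < y) → i ∈ I :=
      fun i h1 h2 h3 => hcore (mem_edgeCore.2 ⟨⟨h1, h2⟩, h3⟩)
    refine ⟨⟨?_, ?_⟩, hxy⟩
    · by_contra hcon
      rw [not_or] at hcon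
      have hxU : x ∉ Up := by
        intro hxU
        have := hUp' x hxU
        have := hmin x (hmem x (by omega) (by omega) (by simp [hxU]))
        omega
      -- If `x < a`, the core contains `a ∉ I`; if `a < x < g`, the down label `x` would be an
      -- element of `I` below its minimum.
      rcases lt_or_gt_of_ne hcon.1 with h | h
      · refine hgap.left_notMem (hmem a (by omega) (by omega) ?_)
        rw [if_neg haU]
        omega
      · have := hmin x (hgap.subset (mem_downInt.2 ⟨⟨by omega, hxU⟩, h, by omega⟩))
        omega
    · by_contra hcon
      rw [not_or] at hcon
      have hyU : y ∉ Up := by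
        intro hyU
        have := hUp' y hyU
        have := hmax y (hmem y (by omega) (by omega) (by simp [hyU]))
        omega
      rcases lt_or_gt_of_ne hcon.1 with h | h
      · have := hmax y (hgap.subset (mem_downInt.2 ⟨⟨by omega, hyU⟩, by omega, h⟩))
        omega
      · refine hgap.right_notMem (hmem b (by omega) (by omega) ?_)
        rw [if_neg hbU]
        omega
  · rintro ⟨⟨hx, hy⟩, hxy⟩
    refine ⟨⟨hxy, by omega⟩, fun i hi => ?_, fun i hi => ?_⟩
    · rw [mem_edgeCore] at hi
      obtain ⟨hin, hi⟩ := hi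
      split_ifs at hi with hiU
      · rcases hi with rfl | rfl
        · rcases hx with rfl | rfl
          · exact absurd hiU haU
          · exact hg
        · rcases hy with rfl | rfl
          · exact absurd hiU hbU
          · exact hG
      · exact hgap.subset (mem_downInt.2 ⟨⟨hin, hiU⟩, by omega, by omega⟩)
    · have h1 := hmin i hi
      have h2 := hmax i hi
      rw [Finset.mem_Icc]
      omega

/-- The sign convention is what turns the path length into a difference of start positions,
uniformly in the type of `g`. -/
theorem signedLength_left (hUp : Up ⊆ Finset.Ioo 1 n) {a g b : ℕ} (hag : a < g) (hgb : g < b)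
    (hb : b ≤ n + 1) : signedLength n Up a g b = startPos n Up a - startPos n Up g := by
  have h1 := ccw_eq hUp hag (by omega)
  have h2 := ccw_eq hUp (hag.trans hgb) hb
  have h3 := ccw_swap_eq hUp hag (by omega)
  have h4 := endPos_eq_startPos (Up := Up) (show 1 ≤ g by omega) (show g ≤ n by omega)
  have h5 := startPos_lt_endPos hUp (hag.trans hgb) hb
  have hr : b ∈ Finset.range (n + 2) := Finset.mem_range.2 (by omega)
  rw [signedLength, pathLength]
  by_cases hgU : g ∈ Up
  · have h6 := endPos_lt_of_mem hUp hgb hb hgU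
    rw [if_pos hgU] at h4
    rw [if_neg (fun h => (mem_Do.1 h).2 hgU),
      if_pos (show _ ∈ arc n Up _ _ from Finset.mem_filter.2 ⟨hr, by omega, by omega⟩)]
    omega
  · have h6 := endPos_lt_of_notMem hUp (by omega) hgb hb hgU
    rw [if_neg hgU] at h4
    rw [if_pos (mem_Do.2 ⟨⟨by omega, by omega⟩, hgU⟩), if_neg]
    · omega
    · intro h
      have := (Finset.mem_filter.1 h).2.2
      omega

theorem signedLength_right (hUp : Up ⊆ Finset.Ioo 1 n) {a G b : ℕ} (haG : a < G) (hGb : G < b)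
    (hb : b ≤ n + 1) : signedLength n Up b G a = endPos n Up G - endPos n Up b := by
  have h1 := ccw_swap_eq hUp hGb hb
  have h2 := ccw_swap_eq hUp (haG.trans hGb) hb
  have h3 := ccw_eq hUp hGb hb
  have h4 := endPos_eq_startPos (Up := Up) (show 1 ≤ G by omega) (show G ≤ n by omega)
  have h5 := startPos_lt_endPos hUp (haG.trans hGb) hb
  have hr : a ∈ Finset.range (n + 2) := Finset.mem_range.2 (by omega)
  rw [signedLength, pathLength]
  by_cases hGU : G ∈ Up
  · have h6 := startPos_lt_of_mem (n := n) haG hGU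
    rw [if_pos hGU] at h4
    rw [if_neg (fun h => (mem_Do.1 h).2 hGU), if_neg]
    · omega
    · intro h
      have := (Finset.mem_filter.1 h).2.2
      omega
  · have h6 := startPos_lt_of_notMem haG (show G ≤ n by omega) hGU
    rw [if_neg hGU] at h4
    rw [if_pos (mem_Do.2 ⟨⟨by omega, by omega⟩, hGU⟩),
      if_pos (show _ ∈ arc n Up _ _ from Finset.mem_filter.2 ⟨hr, by omega, by omega⟩)]
    omega

theorem edgeCore_eq_downInt {a b : ℕ} (ha : a ∉ Up) (hb : b ∉ Up) :
    edgeCore n Up a b = downInt n Up a b := by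
  ext i
  rw [mem_edgeCore, mem_downInt, @and_assoc (1 ≤ i ∧ i ≤ n)]
  refine and_congr_right fun _ => ?_
  by_cases hi : i ∈ Up
  · simp only [hi, if_true, not_true, false_and, iff_false]
    rintro (rfl | rfl)
    · exact ha hi
    · exact hb hi
  · simp [hi]

/-- The Minkowski coefficient of a nested set. -/
theorem minkCoeff_eq (hUp : Up ⊆ Finset.Ioo 1 n) (hI : I ⊆ Finset.Icc 1 n) (hne : I.Nonempty)
    {a b : ℕ} (hgap : IsGap n Up I a b) (hab : ∀ i ∈ I, a < i ∧ i < b) :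
    minkCoeff n Up I = (-1) ^ (I \ downInt n Up a b).card *
      ((signedLength n Up a (I.min' hne) b : ℝ) * (signedLength n Up b (I.max' hne) a : ℝ)
        - if ∃ u ∈ Up, I = {u} then (n : ℝ) + 1 else 0) := by
  set g := I.min' hne with hgdef
  set G := I.max' hne with hGdef
  have hg : g ∈ I := I.min'_mem hne
  have hG : G ∈ I := I.max'_mem hne
  have hmin : ∀ i ∈ I, g ≤ i := fun i hi => I.min'_le i hi
  have hmax : ∀ i ∈ I, i ≤ G := fun i hi => I.le_max' i hi
  have hag := (hab g hg).1
  have hGb := (hab G hG).2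
  have hb := le_of_mem_DoBar hgap.right
  have hgn := Finset.mem_Icc.1 (hI hg)
  have hgG := hmin G hG
  have haU := notMem_Up_of_mem_DoBar hUp hgap.left
  have hbU := notMem_Up_of_mem_DoBar hUp hgap.right
  have hsd := edgeDefect_second_difference (n := n) (Up := Up) a b g G
  have hsl := signedLength_left hUp hag (hgG.trans_lt hGb) hb
  have hsr := signedLength_right hUp (hag.trans_le hgG) hGb hb
  have s1 := sign_left (Up := Up) hI hg hmin hag (hgG.trans_lt hGb)
  have s2 := sign_right (Up := Up) hI hG hmax (hag.trans_le hgG) hGb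
  rw [edgeCore_eq_downInt haU hbU] at s1 s2
  rw [minkCoeff, coreSum, coreEdges_eq hgap hUp hI hg hG hmin hmax hag hGb, Finset.sum_filter,
    Finset.sum_product, Finset.sum_pair hag.ne, Finset.sum_pair hGb.ne', Finset.sum_pair hGb.ne',
    if_pos (show a < b by omega), if_pos (show a < G by omega), if_pos (show g < b by omega),
    edgeCore_eq_downInt haU hbU, s1, s2, hsl, hsr]
  push_cast
  -- If `g = G`, the edge from `g` to itself is not in the sum although the second difference needs
  -- it. Its formal defect is `tri n` for a down label, matched by the singleton term of
  -- `minkCoeff`, and `-(n + 1)` for an up label, which remains as the correction.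
  rcases hgG.eq_or_lt with heq | hlt
  · have hIg : I = {g} := by
      ext i
      rw [Finset.mem_singleton]
      refine ⟨fun hi => ?_, fun hi => hi ▸ hg⟩
      have := hmin i hi
      have := hmax i hi
      omega
    have hex : ∀ S : Finset ℕ, (∃ d ∈ S, I = {d}) ↔ g ∈ S := by
      intro S
      constructor
      · rintro ⟨d, hd, h⟩
        rw [h, Finset.mem_singleton] at hg
        rwa [hg]
      · intro h
        exact ⟨g, h, hIg⟩
    rw [if_neg (show ¬ g < G by omega), if_congr (hex _) rfl rfl, if_congr (hex _) rfl rfl]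
    rw [← heq] at hsd ⊢
    have hgg : edgeDefect n Up g g = if g ∈ Up then -((n : ℝ) + 1) else tri n := by
      rw [edgeDefect, endPos_eq_startPos hgn.1 hgn.2]
      split_ifs
      · push_cast
        simp only [tri]
        ring
      · push_cast
        simp only [tri]
        ring
    rw [hgg] at hsd
    by_cases hgU : g ∈ Up
    · rw [if_pos hgU] at hsd ⊢
      rw [if_neg (by simp [mem_Do, hgU])]
      linear_combination -(-1 : ℝ) ^ (I \ downInt n Up a b).card * hsd
    · rw [if_neg hgU] at hsd ⊢
      have hempty : I \ downInt n Up a b = ∅ := by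
        rw [Finset.sdiff_eq_empty_iff_subset]
        intro i hi
        have : i = g := by
          rw [hIg] at hi
          exact Finset.mem_singleton.1 hi
        subst this
        exact mem_downInt.2 ⟨⟨hgn, hgU⟩, hab _ hi⟩
      rw [if_pos (mem_Do.2 ⟨hgn, hgU⟩), hempty]
      simp only [Finset.card_empty, pow_zero]
      linear_combination -hsd
  · have hex : ∀ S : Finset ℕ, ¬ ∃ d ∈ S, I = {d} := by
      rintro S ⟨d, -, h⟩
      rw [h, Finset.mem_singleton] at hg hG
      omega
    have s3 := sign_left (Up := Up) hI hg hmin hag hlt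
    rw [if_pos hlt, s3, s2, if_neg (hex _), if_neg (hex _)]
    linear_combination -(-1 : ℝ) ^ (I \ downInt n Up a b).card * hsd

end Nested

end CAssoc

/-! ### Existence and values of the Minkowski coefficients. -/

theorem mainTheorem3 (n : ℕ) (hn : 1 ≤ n) (Up : Finset ℕ) (hUp : Up ⊆ Finset.Ioo 1 n) :
    (∃ y : Finset ℕ → ℝ,
      CAssoc.IsMinkowskiDecomposition n (CAssoc.associahedron n Up) y) ∧
    ∀ y : Finset ℕ → ℝ,
      CAssoc.IsMinkowskiDecomposition n (CAssoc.associahedron n Up) y →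
      ∀ (I : Finset ℕ) (_ : I ⊆ Finset.Icc 1 n) (hI : I.Nonempty) (v w : ℕ),
        CAssoc.decompType n Up I = (v, w) →
        (v = 1 → ∀ a b : ℕ, CAssoc.downIntervals n Up I = {(a, b)} →
          ((¬ ∃ u ∈ Up, I = {u}) →
            y I = (-1 : ℝ) ^ (I \ CAssoc.downInt n Up a b).card *
              ((CAssoc.signedLength n Up a (I.min' hI) b : ℝ) *
                (CAssoc.signedLength n Up b (I.max' hI) a : ℝ))) ∧
          ((∃ u ∈ Up, I = {u}) →
            y I = (-1 : ℝ) ^ (I \ CAssoc.downInt n Up a b).card *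
              ((CAssoc.signedLength n Up a (I.min' hI) b : ℝ) *
                (CAssoc.signedLength n Up b (I.max' hI) a : ℝ) - ((n : ℝ) + 1)))) ∧
        (2 ≤ v → y I = 0) := by
  have hiff := CAssoc.isMinkowskiDecomposition_iff (CAssoc.hasSupport_associahedron hn hUp)
    CAssoc.convex_associahedron CAssoc.isClosed_associahedron
  refine ⟨⟨CAssoc.minkCoeff n Up, (hiff _).2 fun J hJ => CAssoc.sum_minkCoeff hn hUp hJ⟩, ?_⟩
  intro y hy I hIn hI v w hvw
  have hyI : y I = CAssoc.minkCoeff n Up I :=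
    CAssoc.eq_of_sum_powerset_eq (fun J hJ =>
      ((hiff y).1 hy J hJ).trans (CAssoc.sum_minkCoeff hn hUp hJ).symm) hIn hI
  have hv : (CAssoc.downIntervals n Up I).card = v := congrArg Prod.fst hvw
  refine ⟨fun _ a b hab => ?_, fun h2 => ?_⟩
  · have hq : (a, b) ∈ CAssoc.downIntervals n Up I := hab ▸ Finset.mem_singleton_self _
    have hgap := (CAssoc.downIntervals_spec hIn hq).1
    have hmem : ∀ i ∈ I, a < i ∧ i < b := by
      intro i hi
      obtain ⟨q, hq, h⟩ := CAssoc.exists_mem_downIntervals hUp hIn hi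
      rw [hab, Finset.mem_singleton] at hq
      subst hq
      exact h
    rw [hyI, CAssoc.minkCoeff_eq hUp hIn hI hgap hmem]
    refine ⟨fun h => ?_, fun h => ?_⟩
    · rw [if_neg h, sub_zero]
    · rw [if_pos h]
  · rw [hyI]
    exact CAssoc.minkCoeff_eq_zero hIn (hv ▸ h2)
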